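/- Let $\mathbb{H}$ be the quaternions, let $X^{\mathsf H}$ denote the conjugate transpose of a quaternionic matrix, and let $\mathrm{Sp}(n)=\{Q\in\mathbb{H}^{n\times n}: Q^{\mathsf H}Q=I\}$ be the compact symplectic group, which is an embedded submanifold of $\mathbb{H}^{n\times n}$. Let $\mathsf{Q}^2(\mathbb{H}^n)=\{X\in\mathbb{H}^{n\times n}:X^{\mathsf H}=X\}$. Each set of matrices on the left below is an embedded smooth submanifold of the space of matrices; each coset space on the right is a smooth manifold with the unique smooth structure for which the projection from $\mathrm{Sp}(n)$ is a smooth submersion; and there are $\mathrm{Sp}(n)$-equivariant diffeomorphisms as follows. (1) (Stiefel manifold) For $0\le k\le n$, $$\{X\in\mathbb{H}^{n\times k}: X^{\mathsf H}X=I\}\;\cong\;\mathrm{Sp}(n)/\mathrm{Sp}(n-k),$$ where $\mathrm{Sp}(n)$ acts on the left side by $Q\cdot X=QX$, and $\mathrm{Sp}(n-k)$ is the subgroup $\{\mathrm{diag}(I_k,W):W\in\mathrm{Sp}(n-k)\}$. The coset of $Q$ corresponds to the matrix of the first $k$ columns of $Q$. (2) (Grassmann manifold) For $0\le k\le n$ and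 $\Delta=\mathrm{diag}(I_k,-I_{n-k})$, $$\{Q\Delta Q^{\mathsf H}\in\mathsf{Q}^2(\mathbb{H}^n):Q\in\mathrm{Sp}(n)\}\;\cong\;\mathrm{Sp}(n)/\bigl(\mathrm{Sp}(k)\times\mathrm{Sp}(n-k)\bigr).$$ (3) (Flag manifold) For integers $0<k_1<\dots<k_p<n$, with $k_0=0$ and $k_{p+1}=n$, for pairwise distinct real numbers $a_1,\dots,a_{p+1}$ and $\Delta_a=\mathrm{diag}(a_1I_{k_1-k_0},\dots,a_{p+1}I_{k_{p+1}-k_p})$, $$\{Q\Delta_aQ^{\mathsf H}\in\mathsf{Q}^2(\mathbb{H}^n):Q\in\mathrm{Sp}(n)\}\;\cong\;\mathrm{Sp}(n)/\bigl(\mathrm{Sp}(k_1)\times\mathrm{Sp}(k_2-k_1)\times\dots\times\mathrm{Sp}(n-k_p)\bigr).$$ In (2) and (3), $\mathrm{Sp}(n)$ acts on the left side by conjugation, $P\cdot X=PXP^{\mathsf H}$, the products of groups are embedded in $\mathrm{Sp}(n)$ as block-diagonal matrices, and the coset of $Q$ corresponds to $Q\Delta Q^{\mathsf H}$, respectively $Q\Delta_aQ^{\mathsf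 H}$. In all cases $\mathrm{Sp}(n)$ acts on the coset space by left multiplication. -/

import Mathlib

open scoped Manifold ContDiff Quaternion Matrix

/- Any norm on a space of matrices induces the same smooth structure; the entrywise sup norm,
whose topology is Mathlib's topology on matrices, is used to view `ℍ^{m × n}` as a normed space. -/
attribute [local instance] Matrix.normedAddCommGroup Matrix.normedSpace

noncomputable section

/-! ### The groups -/

/-- `ℍ^{m × n}`, the `m × n` quaternionic matrices. -/
abbrev QMat (m n : ℕ) : Type := Matrix (Fin m) (Fin n) ℍ[ℝ]

/-- The compact symplectic group `Sp(n)` of quaternionic unitary `n × n` matrices. It carries the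
subspace topology of `ℍ^{n × n}`. -/
abbrev CompactSp (n : ℕ) : Type := unitary (QMat n n)

/-- `Sp(n) = {Q : Qᴴ Q = 1}`: the condition `Q Qᴴ = 1` is automatic. -/
theorem mem_compactSp_iff {n : ℕ} {Q : QMat n n} : Q ∈ unitary (QMat n n) ↔ Qᴴ * Q = 1 := by
  rw [Unitary.mem_iff, Matrix.star_eq_conjTranspose]
  exact ⟨fun h => h.1, fun h => ⟨h, mul_eq_one_symm h⟩⟩

/-! ### Block-diagonal matrices with two blocks -/

/-- The first `k` and the last `n - k` of the `n` indices. -/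
def twoBlockEquiv {n k : ℕ} (hk : k ≤ n) : Fin k ⊕ Fin (n - k) ≃ Fin n :=
  finSumFinEquiv.trans (finCongr (Nat.add_sub_of_le hk))

/-- `diag(A, B)`. -/
def twoBlock {n k : ℕ} (hk : k ≤ n) (A : QMat k k) (B : QMat (n - k) (n - k)) : QMat n n :=
  Matrix.reindex (twoBlockEquiv hk) (twoBlockEquiv hk) (Matrix.fromBlocks A 0 0 B)

theorem twoBlock_one {n k : ℕ} (hk : k ≤ n) : twoBlock hk 1 1 = 1 := by
  simp [twoBlock]

theorem twoBlock_mul {n k : ℕ} (hk : k ≤ n) (A A' : QMat k k) (B B' : QMat (n - k) (n - k)) :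
    twoBlock hk (A * A') (B * B') = twoBlock hk A B * twoBlock hk A' B' := by
  simp [twoBlock, Matrix.submatrix_mul_equiv, Matrix.fromBlocks_multiply]

theorem twoBlock_conjTranspose {n k : ℕ} (hk : k ≤ n) (A : QMat k k) (B : QMat (n - k) (n - k)) :
    (twoBlock hk A B)ᴴ = twoBlock hk Aᴴ Bᴴ := by
  simp [twoBlock, Matrix.conjTranspose_submatrix, Matrix.fromBlocks_conjTranspose]

/-- The embedding `Sp(k) × Sp(n - k) → Sp(n)`, `(U, W) ↦ diag(U, W)`. -/
def twoBlockHom {n k : ℕ} (hk : k ≤ n) : CompactSp k × CompactSp (n - k) →* CompactSp n where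
  toFun W := ⟨twoBlock hk W.1 W.2, mem_compactSp_iff.2 (by
    rw [twoBlock_conjTranspose, ← twoBlock_mul, mem_compactSp_iff.1 W.1.2,
      mem_compactSp_iff.1 W.2.2, twoBlock_one])⟩
  map_one' := Subtype.ext (twoBlock_one hk)
  map_mul' _ _ := Subtype.ext (twoBlock_mul hk _ _ _ _)

/-- `Sp(n - k)` as the subgroup `{diag(I_k, W) : W ∈ Sp(n - k)}` of `Sp(n)`. -/
def stiefelSubgroup {n k : ℕ} (hk : k ≤ n) : Subgroup (CompactSp n) :=
  ((twoBlockHom hk).comp (MonoidHom.inr (CompactSp k) (CompactSp (n - k)))).range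

/-- `Sp(k) × Sp(n - k)` as the subgroup `{diag(U, W)}` of `Sp(n)`. -/
def grassmannSubgroup {n k : ℕ} (hk : k ≤ n) : Subgroup (CompactSp n) :=
  (twoBlockHom hk).range

/-- `Δ = diag(I_k, -I_{n-k})`. -/
def grassmannDelta {n k : ℕ} (hk : k ≤ n) : QMat n n := twoBlock hk 1 (-1)

/-! ### Block-diagonal matrices with `p + 1` blocks -/

/-- The sequence `k_0 = 0, k_1, …, k_p, k_{p+1} = n`. -/
def flagBound (n : ℕ) {p : ℕ} (k : Fin p → ℕ) : Fin (p + 2) → ℕ :=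
  Fin.cons (α := fun _ => ℕ) 0 (Fin.snoc (α := fun _ => ℕ) k n)

/-- The block sizes `k_1 - k_0, …, k_{p+1} - k_p`. -/
def flagSize (n : ℕ) {p : ℕ} (k : Fin p → ℕ) (j : Fin (p + 1)) : ℕ :=
  flagBound n k j.succ - flagBound n k j.castSucc

theorem flagBound_monotone {n p : ℕ} {k : Fin p → ℕ} (hk : StrictMono k) (hn : ∀ j, k j < n) :
    Monotone (flagBound n k) := by
  intro x y hxy
  induction x using Fin.cases with
  | zero => simp [flagBound]
  | succ x =>
    induction y using Fin.cases with
    | zero => simp at hxy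
    | succ y =>
      rw [Fin.succ_le_succ_iff] at hxy
      simp only [flagBound, Fin.cons_succ]
      induction y using Fin.lastCases with
      | last =>
        induction x using Fin.lastCases with
        | last => exact le_rfl
        | cast x => simpa using (hn x).le
      | cast y =>
        induction x using Fin.lastCases with
        | last => exact absurd hxy (not_le.2 (Fin.castSucc_lt_last y))
        | cast x => simpa using hk.monotone (by simpa using hxy)

theorem sum_flagSize {n p : ℕ} {k : Fin p → ℕ} (hk : StrictMono k) (hn : ∀ j, k j < n) :
    ∑ j, flagSize n k j = n := by
  have key : ∀ (m : ℕ) (f : Fin (m + 1) → ℕ), Monotone f →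
      ∑ j : Fin m, (f j.succ - f j.castSucc) = f (Fin.last m) - f 0 := by
    intro m
    induction m with
    | zero => intro f _; simp
    | succ m ih =>
      intro f hf
      rw [Fin.sum_univ_castSucc]
      have := ih (fun i => f i.castSucc) (fun a b h => hf (by simpa using h))
      simp only [Fin.succ_castSucc, Fin.castSucc_zero, Fin.succ_last] at this ⊢
      rw [this]
      have h1 : f 0 ≤ f (Fin.last m).castSucc := hf (Fin.zero_le _)
      have h2 : f (Fin.last m).castSucc ≤ f (Fin.last m.succ) := hf (Fin.le_last _)
      change f (Fin.last m).castSucc - f 0 + (f (Fin.last m.succ) - f (Fin.last m).castSucc) =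
        f (Fin.last m.succ) - f 0
      omega
  have := key (p + 1) (flagBound n k) (flagBound_monotone hk hn)
  simp only [flagSize, this]
  simp [flagBound, ← Fin.succ_last]

/-- The consecutive blocks of `k_1 - k_0, …, k_{p+1} - k_p` indices among the `n` indices. -/
def flagEquiv {n p : ℕ} {k : Fin p → ℕ} (hk : StrictMono k) (hn : ∀ j, k j < n) :
    (Σ j : Fin (p + 1), Fin (flagSize n k j)) ≃ Fin n :=
  finSigmaFinEquiv.trans (finCongr (sum_flagSize hk hn))

/-- `diag(M_1, …, M_{p+1})`. -/
def flagBlock {n p : ℕ} {k : Fin p → ℕ} (hk : StrictMono k) (hn : ∀ j, k j < n)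
    (M : ∀ j, QMat (flagSize n k j) (flagSize n k j)) : QMat n n :=
  Matrix.reindex (flagEquiv hk hn) (flagEquiv hk hn) (Matrix.blockDiagonal' M)

theorem flagBlock_one {n p : ℕ} {k : Fin p → ℕ} (hk : StrictMono k) (hn : ∀ j, k j < n) :
    flagBlock hk hn (fun _ => 1) = 1 := by
  have : Matrix.blockDiagonal' (fun j => (1 : QMat (flagSize n k j) (flagSize n k j))) = 1 :=
    Matrix.blockDiagonal'_one
  simp [flagBlock, this]

theorem flagBlock_mul {n p : ℕ} {k : Fin p → ℕ} (hk : StrictMono k) (hn : ∀ j, k j < n)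
    (M N : ∀ j, QMat (flagSize n k j) (flagSize n k j)) :
    flagBlock hk hn (fun j => M j * N j) = flagBlock hk hn M * flagBlock hk hn N := by
  simp [flagBlock, Matrix.submatrix_mul_equiv, Matrix.blockDiagonal'_mul]

theorem flagBlock_conjTranspose {n p : ℕ} {k : Fin p → ℕ} (hk : StrictMono k)
    (hn : ∀ j, k j < n) (M : ∀ j, QMat (flagSize n k j) (flagSize n k j)) :
    (flagBlock hk hn M)ᴴ = flagBlock hk hn (fun j => (M j)ᴴ) := by
  simp [flagBlock, Matrix.conjTranspose_submatrix, Matrix.blockDiagonal'_conjTranspose]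

/-- The embedding `Sp(k_1) × Sp(k_2 - k_1) × ⋯ × Sp(n - k_p) → Sp(n)`,
`(W_1, …, W_{p+1}) ↦ diag(W_1, …, W_{p+1})`. -/
def flagBlockHom {n p : ℕ} {k : Fin p → ℕ} (hk : StrictMono k) (hn : ∀ j, k j < n) :
    (∀ j, CompactSp (flagSize n k j)) →* CompactSp n where
  toFun W := ⟨flagBlock hk hn (fun j => W j), mem_compactSp_iff.2 (by
    rw [flagBlock_conjTranspose, ← flagBlock_mul, ← flagBlock_one hk hn]
    exact congrArg _ (funext fun j => mem_compactSp_iff.1 (W j).2))⟩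
  map_one' := Subtype.ext (flagBlock_one hk hn)
  map_mul' _ _ := Subtype.ext (flagBlock_mul hk hn _ _)

/-- `Sp(k_1) × Sp(k_2 - k_1) × ⋯ × Sp(n - k_p)` as the subgroup of block-diagonal matrices
of `Sp(n)`. -/
def flagSubgroup {n p : ℕ} {k : Fin p → ℕ} (hk : StrictMono k) (hn : ∀ j, k j < n) :
    Subgroup (CompactSp n) :=
  (flagBlockHom hk hn).range

/-- `Δ_a = diag(a_1 I_{k_1 - k_0}, …, a_{p+1} I_{k_{p+1} - k_p})`. -/
def flagDelta {n p : ℕ} {k : Fin p → ℕ} (hk : StrictMono k) (hn : ∀ j, k j < n)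
    (a : Fin (p + 1) → ℝ) : QMat n n :=
  flagBlock hk hn (fun j => a j • 1)

/-! ### The sets of matrices and the actions of `Sp(n)` -/

/-- `{X ∈ ℍ^{n × k} : Xᴴ X = I}`. -/
def quatStiefel (n k : ℕ) : Set (QMat n k) := {X | Xᴴ * X = 1}

/-- `Sp(n)` acts on `{X : Xᴴ X = I}` by left multiplication. -/
instance quatStiefel.instMulAction (n k : ℕ) : MulAction (CompactSp n) (quatStiefel n k) where
  smul Q X := ⟨(Q : QMat n n) * (X : QMat n k), by
    have hX : (X : QMat n k)ᴴ * (X : QMat n k) = 1 := X.2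
    have hQ := mem_compactSp_iff.1 Q.2
    change ((Q : QMat n n) * (X : QMat n k))ᴴ * ((Q : QMat n n) * (X : QMat n k)) = 1
    rw [Matrix.conjTranspose_mul, Matrix.mul_assoc, ← Matrix.mul_assoc (Q : QMat n n)ᴴ, hQ,
      Matrix.one_mul, hX]⟩
  one_smul X := Subtype.ext (Matrix.one_mul _)
  mul_smul P Q X := Subtype.ext (Matrix.mul_assoc _ _ _)

/-- `{Q D Qᴴ ∈ 𝖰²(ℍⁿ) : Q ∈ Sp(n)}`, where `𝖰²(ℍⁿ) = {X : Xᴴ = X}`. -/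
def quatConjOrbit {n : ℕ} (D : QMat n n) : Set (QMat n n) :=
  {X | Xᴴ = X ∧ ∃ Q : CompactSp n, X = (Q : QMat n n) * D * (Q : QMat n n)ᴴ}

/-- `Sp(n)` acts on `{Q D Qᴴ}` by conjugation, `P • X = P X Pᴴ`. -/
instance quatConjOrbit.instMulAction {n : ℕ} (D : QMat n n) :
    MulAction (CompactSp n) (quatConjOrbit D) where
  smul P X := ⟨(P : QMat n n) * (X : QMat n n) * (P : QMat n n)ᴴ, by
    obtain ⟨X, hX, Q, hQ⟩ := X
    refine ⟨?_, P * Q, ?_⟩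
    · simp only [Matrix.conjTranspose_mul, Matrix.conjTranspose_conjTranspose, hX,
        Matrix.mul_assoc]
    · simp only [hQ, Submonoid.coe_mul, Matrix.conjTranspose_mul, Matrix.mul_assoc]⟩
  one_smul X := Subtype.ext (by
    change (1 : QMat n n) * (X : QMat n n) * (1 : QMat n n)ᴴ = _
    simp)
  mul_smul P Q X := Subtype.ext (by
    change ((P : QMat n n) * (Q : QMat n n)) * (X : QMat n n) * ((P : QMat n n) * (Q : QMat n n))ᴴ
      = (P : QMat n n) * ((Q : QMat n n) * (X : QMat n n) * (Q : QMat n n)ᴴ) * (P : QMat n n)ᴴ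
    simp only [Matrix.conjTranspose_mul, Matrix.mul_assoc])

/-! ### Smooth structures -/

/-- The atlas `c` makes `M` an embedded smooth `d`-dimensional submanifold of the normed space `E`
through `ι : M → E`. There is at most one such smooth structure. -/
structure IsEmbeddedStructure {M E : Type} [TopologicalSpace M] [NormedAddCommGroup E]
    [NormedSpace ℝ E] (ι : M → E) (d : ℕ) (c : ChartedSpace (EuclideanSpace ℝ (Fin d)) M) :
    Prop where
  isManifold : IsManifold (𝓡 d) ∞ M
  isSmoothEmbedding : Manifold.IsSmoothEmbedding (𝓡 d) 𝓘(ℝ, E) ∞ ι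

/-- The atlas `c` makes the coset space `G ⧸ H` (with the quotient topology) a smooth homogeneous
space of `G`: it is a smooth manifold and the projection `G → G ⧸ H` is a smooth submersion.
There is at most one such smooth structure. -/
structure IsHomogeneousStructure {G : Type} [Group G] [TopologicalSpace G] (m : ℕ)
    (cG : ChartedSpace (EuclideanSpace ℝ (Fin m)) G) (H : Subgroup G) (d : ℕ)
    (c : ChartedSpace (EuclideanSpace ℝ (Fin d)) (G ⧸ H)) : Prop where
  isManifold : IsManifold (𝓡 d) ∞ (G ⧸ H)
  isSubmersion : Manifold.IsSubmersion (𝓡 m) (𝓡 d) ∞ (QuotientGroup.mk : G → G ⧸ H)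

/-- `S` is an embedded submanifold of `E`, the coset space `Sp(n) ⧸ H` is a smooth homogeneous
space, and there is an `Sp(n)`-equivariant diffeomorphism `S ≅ Sp(n) ⧸ H` under which the coset of
`Q` corresponds to the point `f Q` of `S`. Smoothness refers to the embedded structures of `Sp(n)`
(in `ℍ^{n × n}`) and of `S` (in `E`), and to the homogeneous structure of `Sp(n) ⧸ H`. -/
structure IsEquivariantModel {n : ℕ} {E : Type} [NormedAddCommGroup E] [NormedSpace ℝ E]
    (S : Set E) [MulAction (CompactSp n) S] (H : Subgroup (CompactSp n)) (f : CompactSp n → E) :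
    Prop where
  exists_embedded :
    ∃ (d : ℕ) (c : ChartedSpace (EuclideanSpace ℝ (Fin d)) S),
      IsEmbeddedStructure (Subtype.val : S → E) d c
  exists_homogeneous :
    ∀ (m : ℕ) (cG : ChartedSpace (EuclideanSpace ℝ (Fin m)) (CompactSp n)),
      IsEmbeddedStructure (Subtype.val : CompactSp n → QMat n n) m cG →
      ∃ (d : ℕ) (c : ChartedSpace (EuclideanSpace ℝ (Fin d)) (CompactSp n ⧸ H)),
        IsHomogeneousStructure m cG H d c
  exists_diffeomorph :
    ∀ (m : ℕ) (cG : ChartedSpace (EuclideanSpace ℝ (Fin m)) (CompactSp n))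
      (d : ℕ) (cS : ChartedSpace (EuclideanSpace ℝ (Fin d)) S)
      (d' : ℕ) (cQ : ChartedSpace (EuclideanSpace ℝ (Fin d')) (CompactSp n ⧸ H)),
      IsEmbeddedStructure (Subtype.val : CompactSp n → QMat n n) m cG →
      IsEmbeddedStructure (Subtype.val : S → E) d cS →
      IsHomogeneousStructure m cG H d' cQ →
      ∃ φ : S ≃ₘ^∞⟮𝓡 d, 𝓡 d'⟯ (CompactSp n ⧸ H),
        (∀ (P : CompactSp n) (X : S), φ (P • X) = P • φ X) ∧
        ∀ Q : CompactSp n, (φ.symm (Q : CompactSp n ⧸ H) : E) = f Q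

end

/-! Each of the sets is the orbit of a point `x₀` under a linear action of `Sp(n)`, and everything
follows from one fact: near `x₀` there is an analytic map `σ` from the ambient space to matrices,
unitary-valued near `x₀`, with `σ X • x₀ = X` for `X` in the orbit. Then `X ↦ σ X • x₀` is an
analytic local retraction onto the orbit, and its derivative at `x₀` is a projection; this gives a
slice chart at `x₀`, which the linear action carries to every other point. The same section shows
that the bijection from the coset space to the orbit is a homeomorphism, that the projection is a
submersion for the structure pulled back from the orbit, and that for any admissible structures the
bijection is a diffeomorphism: one direction descends along the submersion, the other is locally
section followed by projection. `IsLinearOrbit` collects the hypotheses of this argument.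

The sections come from the polar decomposition: an explicit polynomial map `W` with `W(x₀) = 1`
moves `x₀` to `X` correctly but is not unitary, and its unitary part `pol (W X)` still does so
(`exists_smooth_polar`, `exists_section_stiefel`, `exists_section_conj`). For Grassmann and flag
manifolds `x₀` is a real diagonal matrix, and `W` is assembled from the spectral projections of `X`,
which are polynomials in `X` by Lagrange interpolation. Stabilizers are read off entrywise:
commuting with a real diagonal matrix means vanishing between distinct eigenvalues. -/

/-! ### Slice charts and embedded submanifolds of a normed space -/

section Slice

open Set Filter Topology

variable {E F : Type*} [NormedAddCommGroup E] [NormedSpace ℝ E]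
  [NormedAddCommGroup F] [NormedSpace ℝ F]

/-- The inverse function theorem for a `C^n` function on an open set. -/
theorem ContDiffOn.exists_openPartialHomeomorph [CompleteSpace E] {f : E → F} {U : Set E}
    {n : ℕ∞ω} (hf : ContDiffOn ℝ n f U) (hU : IsOpen U) (hn : 1 ≤ n) {a : E} (ha : a ∈ U)
    (f' : E ≃L[ℝ] F) (hf' : HasFDerivAt f (f' : E →L[ℝ] F) a) :
    ∃ e : OpenPartialHomeomorph E F, a ∈ e.source ∧ e.source ⊆ U ∧ (∀ x, e x = f x) ∧
      ContDiffOn ℝ n e e.source ∧ ContDiffOn ℝ n e.symm e.target := by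
  have hn0 : n ≠ 0 := fun h => by simp [h] at hn
  have hfa : ∀ x ∈ U, ContDiffAt ℝ n f x := fun x hx => hf.contDiffAt (hU.mem_nhds hx)
  set e₀ := (hfa a ha).toOpenPartialHomeomorph f hf' hn0
  -- Restricting to the points with invertible derivative, an open set, makes the inverse smooth on
  -- the whole target and not only at the image of `a`.
  have hN : IsOpen (U ∩ fderiv ℝ f ⁻¹' range ((↑) : (E ≃L[ℝ] F) → E →L[ℝ] F)) :=
    (hf.continuousOn_fderiv_of_isOpen hU hn).isOpen_inter_preimage hU ContinuousLinearEquiv.isOpen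
  have hsub : (e₀.restrOpen _ hN).source ⊆
      U ∩ fderiv ℝ f ⁻¹' range ((↑) : (E ≃L[ℝ] F) → E →L[ℝ] F) := by
    rw [OpenPartialHomeomorph.restrOpen_source]
    exact inter_subset_right
  refine ⟨e₀.restrOpen _ hN, ?_, hsub.trans inter_subset_left, fun x => rfl,
    hf.mono (hsub.trans inter_subset_left), fun y hy => ?_⟩
  · rw [OpenPartialHomeomorph.restrOpen_source]
    exact ⟨ContDiffAt.mem_toOpenPartialHomeomorph_source _ hf' hn0, ha, f', hf'.fderiv.symm⟩
  · obtain ⟨hxU, g, hg⟩ := hsub ((e₀.restrOpen _ hN).map_target hy)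
    refine ((e₀.restrOpen _ hN).contDiffAt_symm hy (f₀' := g) ?_ (hfa _ hxU)).contDiffWithinAt
    rw [hg]
    exact ((hfa _ hxU).differentiableAt hn0).hasFDerivAt

/-- `e` is a smooth chart of `E` which straightens the set `S` to `ℝ^d × {0}`, in the
decomposition `L` of `E`. -/
structure IsSliceChart {d : ℕ} (S : Set E) (L : (EuclideanSpace ℝ (Fin d) × F) ≃L[ℝ] E)
    (e : OpenPartialHomeomorph E E) : Prop where
  contDiffOn : ContDiffOn ℝ ∞ e e.source
  contDiffOn_symm : ContDiffOn ℝ ∞ e.symm e.target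
  mem_iff : ∀ y ∈ e.source, y ∈ S ↔ (L.symm (e y)).2 = 0

/-- Slice charts are transported by linear automorphisms preserving the set. -/
theorem IsSliceChart.comp_linear {d : ℕ} {S : Set E}
    {L : (EuclideanSpace ℝ (Fin d) × F) ≃L[ℝ] E} {e : OpenPartialHomeomorph E E}
    (he : IsSliceChart S L e) (T : E ≃L[ℝ] E) (hT : ∀ y, T y ∈ S ↔ y ∈ S) :
    IsSliceChart S L (T.toHomeomorph.transOpenPartialHomeomorph e) where
  contDiffOn := he.contDiffOn.comp T.contDiff.contDiffOn fun _ hx => hx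
  contDiffOn_symm := T.symm.contDiff.comp_contDiffOn he.contDiffOn_symm
  mem_iff y hy := by rw [← hT]; exact he.mem_iff (T y) hy

/-- A smooth local retraction onto `S` yields a slice chart. -/
theorem exists_isSliceChart_of_retraction {E : Type} [NormedAddCommGroup E] [NormedSpace ℝ E]
    [FiniteDimensional ℝ E] {S : Set E} {x : E}
    {r : E → E} (hr : ContDiffAt ℝ ω r x) (hx : r x = x)
    (hS : ∀ᶠ y in 𝓝 x, r y ∈ S ∧ (y ∈ S → r y = y)) :
    ∃ (d : ℕ) (F : Type) (_ : NormedAddCommGroup F) (_ : NormedSpace ℝ F)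
      (L : (EuclideanSpace ℝ (Fin d) × F) ≃L[ℝ] E) (e : OpenPartialHomeomorph E E),
      IsSliceChart S L e ∧ x ∈ e.source := by
  have hd : HasFDerivAt r (fderiv ℝ r x) x := (hr.differentiableAt (by simp)).hasFDerivAt
  set P := fderiv ℝ r x with hP
  have htend : Tendsto r (𝓝 x) (𝓝 x) := by simpa [ContinuousAt, hx] using hr.continuousAt
  have hrr : ∀ᶠ y in 𝓝 x, r (r y) = r y := by
    filter_upwards [hS, htend.eventually hS] with y h1 h2 using h2.2 h1.1
  -- Differentiating `r ∘ r = r` at the fixed point `x`.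
  have hPP : P.comp P = P := by
    have h1 : HasFDerivAt (r ∘ r) (P.comp P) x := by
      refine HasFDerivAt.comp x ?_ hd
      rwa [hx]
    exact h1.unique (hd.congr_of_eventuallyEq hrr)
  have hPP' : ∀ v, P (P v) = P v := fun v => congrArg (fun A : E →L[ℝ] E => A v) hPP
  -- the linear decomposition
  have hidem : IsIdempotentElem P.toLinearMap := LinearMap.ext hPP'
  have hc : IsCompl P.toLinearMap.range P.toLinearMap.ker := LinearMap.IsIdempotentElem.isCompl hidem
  let ψ : EuclideanSpace ℝ (Fin (Module.finrank ℝ P.toLinearMap.range)) ≃L[ℝ]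
      P.toLinearMap.range := ContinuousLinearEquiv.ofFinrankEq (by simp)
  let L := (ψ.prodCongr (ContinuousLinearEquiv.refl ℝ P.toLinearMap.ker)).trans
    (Submodule.prodEquivOfIsCompl _ _ hc).toContinuousLinearEquiv
  have hL : ∀ u, L u = (ψ u.1 : E) + (u.2 : E) := fun u => rfl
  have hL2 : ∀ z, (L.symm z).2 = 0 ↔ P z = z := by
    intro z
    obtain ⟨u, rfl⟩ := L.surjective z
    obtain ⟨w, hw⟩ := (ψ u.1).2
    have hw' : P (ψ u.1 : E) = ψ u.1 := by rw [← hw]; exact hPP' w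
    have hk : P (u.2 : E) = 0 := u.2.2
    rw [L.symm_apply_apply, hL, map_add, hw', hk]
    simp
  -- the chart
  let φ : E → E := fun y => P (r y - x) + ((y - r y) - P (y - r y))
  have hφ : ContDiffAt ℝ ω φ x := by
    have := P.contDiff (n := ω)
    exact (this.contDiffAt.comp x (hr.sub contDiffAt_const)).add
      ((contDiffAt_id.sub hr).sub (this.contDiffAt.comp x (contDiffAt_id.sub hr)))
  have hφ' : HasFDerivAt φ ((ContinuousLinearEquiv.refl ℝ E : E ≃L[ℝ] E) : E →L[ℝ] E) x := by
    have h1 : HasFDerivAt φ (P.comp P + ((ContinuousLinearMap.id ℝ E - P) -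
        P.comp (ContinuousLinearMap.id ℝ E - P))) x :=
      (P.hasFDerivAt.comp x (hd.sub_const x)).add
        (((hasFDerivAt_id x).sub hd).sub (P.hasFDerivAt.comp x ((hasFDerivAt_id x).sub hd)))
    convert h1 using 1
    ext v
    simp [hPP']
  -- Being `ContDiffAt` at a point is an open condition for order `ω`, but not for order `∞`; hence
  -- the order `ω` for retractions and sections.
  obtain ⟨U, hUsub, hUo, hxU⟩ := mem_nhds_iff.1 (hφ.eventually (by simp))
  have hφU : ContDiffOn ℝ ω φ U := fun y hy =>
    have : ContDiffAt ℝ ω φ y := hUsub hy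
    this.contDiffWithinAt
  obtain ⟨e₀, hxe, -, he₀, hs, ht⟩ := hφU.exists_openPartialHomeomorph hUo (by simp) hxU _ hφ'
  have hsrc := e₀.open_source.mem_nhds hxe
  obtain ⟨V, hVsub, hVo, hxV⟩ := mem_nhds_iff.1
    (hS.and (hrr.and (htend.eventually hsrc)))
  refine ⟨_, _, _, _, L, e₀.restrOpen V hVo, ⟨?_, ?_, ?_⟩, ?_⟩
  · refine ContDiffOn.mono (hs.of_le (by simp)) ?_
    rw [OpenPartialHomeomorph.restrOpen_source]
    exact inter_subset_left
  · refine ContDiffOn.mono (ht.of_le (by simp)) fun y hy => ?_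
    have := (e₀.restrOpen V hVo).map_target hy
    rw [OpenPartialHomeomorph.restrOpen_source] at this
    rw [← (e₀.restrOpen V hVo).right_inv hy]
    exact e₀.map_source this.1
  · intro y hy
    rw [OpenPartialHomeomorph.restrOpen_source] at hy
    obtain ⟨⟨hrS, hret⟩, hrry, hrs⟩ := hVsub hy.2
    have he : (e₀.restrOpen V hVo) y = φ y := he₀ y
    rw [hL2, he]
    constructor
    · intro hyS
      simp [φ, hret hyS, hPP']
    · intro hPφ
      -- If the kernel component vanishes, `y` and `r y` have the same image under the chart, so `y
      -- = r y` lies in `S`.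
      have h0 : (y - r y) - P (y - r y) = 0 := by
        simpa [φ, hPP', sub_eq_zero, eq_comm] using hPφ
      have hE : e₀ y = e₀ (r y) := by
        rw [he₀, he₀]
        simp only [φ, h0, hrry]
        simp
      rw [e₀.injOn hy.1 hrs hE]
      exact hrS
  · rw [OpenPartialHomeomorph.restrOpen_source]
    exact ⟨hxe, hxV⟩

/-- The chart of `M` induced by a slice chart of the image of an embedding `ι : M → E`. -/
noncomputable def IsSliceChart.chart {d : ℕ} {M : Type*} [TopologicalSpace M] [Nonempty M]
    {ι : M → E} (hι : IsEmbedding ι) {L : (EuclideanSpace ℝ (Fin d) × F) ≃L[ℝ] E}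
    {e : OpenPartialHomeomorph E E} (he : IsSliceChart (range ι) L e) :
    OpenPartialHomeomorph M (EuclideanSpace ℝ (Fin d)) :=
  have hinv : ∀ u, L (u, 0) ∈ e.target →
      ι (Function.invFun ι (e.symm (L (u, 0)))) = e.symm (L (u, 0)) := fun u hu =>
    Function.invFun_eq ((he.mem_iff _ (e.map_target hu)).2 (by rw [e.right_inv hu]; simp))
  have hfst : ∀ x, ι x ∈ e.source → L ((L.symm (e (ι x))).1, 0) = e (ι x) := fun x hx => by
    rw [← (he.mem_iff _ hx).1 ⟨x, rfl⟩, Prod.mk.eta, L.apply_symm_apply]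
  { toFun := fun x => (L.symm (e (ι x))).1
    invFun := fun u => Function.invFun ι (e.symm (L (u, 0)))
    source := ι ⁻¹' e.source
    target := {u | L (u, 0) ∈ e.target}
    map_source' := fun x hx => by
      simp only [mem_ofPred_eq, hfst x hx]
      exact e.map_source hx
    map_target' := fun u hu => by
      simp only [mem_preimage, hinv u hu]
      exact e.map_target hu
    left_inv' := fun x hx => by
      rw [hfst x hx, e.left_inv hx]
      exact Function.leftInverse_invFun hι.injective x
    right_inv' := fun u hu => by
      rw [hinv u hu, e.right_inv hu, L.symm_apply_apply]
    open_source := e.open_source.preimage hι.continuous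
    open_target := e.open_target.preimage (by fun_prop)
    continuousOn_toFun := (continuous_fst.comp L.symm.continuous).comp_continuousOn
      (e.continuousOn.comp hι.continuous.continuousOn fun _ hx => hx)
    continuousOn_invFun := by
      rw [hι.continuousOn_iff]
      have hcont : Continuous fun u : EuclideanSpace ℝ (Fin d) => L (u, 0) := by fun_prop
      exact (e.continuousOn_symm.comp hcont.continuousOn fun _ hu => hu).congr
        fun u hu => hinv u hu }

theorem IsSliceChart.apply_chart_symm {d : ℕ} {M : Type*} [TopologicalSpace M] [Nonempty M]
    {ι : M → E} (hι : IsEmbedding ι) {L : (EuclideanSpace ℝ (Fin d) × F) ≃L[ℝ] E}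
    {e : OpenPartialHomeomorph E E} (he : IsSliceChart (range ι) L e)
    {u : EuclideanSpace ℝ (Fin d)} (hu : u ∈ (he.chart hι).target) :
    ι ((he.chart hι).symm u) = e.symm (L (u, 0)) :=
  Function.invFun_eq ((he.mem_iff _ (e.map_target hu)).2 (by rw [e.right_inv hu]; simp))

/-- A topological embedding whose image has slice charts at all its points is the inclusion of
an embedded submanifold. -/
theorem exists_isEmbeddedStructure_of_isSliceChart {d : ℕ} {M E : Type} [TopologicalSpace M]
    [NormedAddCommGroup E] [NormedSpace ℝ E] {ι : M → E} (hι : IsEmbedding ι)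
    (L : (EuclideanSpace ℝ (Fin d) × F) ≃L[ℝ] E)
    (h : ∀ x, ∃ e, IsSliceChart (range ι) L e ∧ ι x ∈ e.source) :
    ∃ c : ChartedSpace (EuclideanSpace ℝ (Fin d)) M, IsEmbeddedStructure ι d c := by
  choose e he hx using h
  let ch : M → OpenPartialHomeomorph M (EuclideanSpace ℝ (Fin d)) := fun x =>
    haveI : Nonempty M := ⟨x⟩
    (he x).chart hι
  let c : ChartedSpace (EuclideanSpace ℝ (Fin d)) M :=
    { atlas := range ch
      chartAt := ch
      mem_chart_source := hx
      chart_mem_atlas := fun x => ⟨x, rfl⟩ }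
  have hman : IsManifold (𝓡 d) ∞ M := by
    refine isManifold_of_contDiffOn _ _ _ ?_
    rintro _ _ ⟨x, rfl⟩ ⟨x', rfl⟩
    have : Nonempty M := ⟨x⟩
    have hmem : ∀ u ∈ ((ch x).symm ≫ₕ ch x').source,
        L (u, 0) ∈ (e x).target ∧ (e x).symm (L (u, 0)) ∈ (e x').source := by
      intro u hu
      rw [OpenPartialHomeomorph.trans_source, mem_inter_iff] at hu
      refine ⟨hu.1, ?_⟩
      rw [← (he x).apply_chart_symm hι hu.1]
      exact hu.2
    have h1 : ContDiffOn ℝ ∞ (fun u : EuclideanSpace ℝ (Fin d) =>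
        (L.symm (e x' ((e x).symm (L (u, 0))))).1) ((ch x).symm ≫ₕ ch x').source := by
      refine (contDiff_fst.comp L.symm.contDiff).comp_contDiffOn
        ((he x').contDiffOn.comp ((he x).contDiffOn_symm.comp ?_ fun u hu => (hmem u hu).1)
          fun u hu => (hmem u hu).2)
      exact (L.contDiff.comp (contDiff_id.prodMk contDiff_const)).contDiffOn
    refine (h1.congr fun u hu => ?_).mono (by simp)
    rw [OpenPartialHomeomorph.trans_source, mem_inter_iff] at hu
    change (L.symm (e x' (ι ((ch x).symm u)))).1 = _
    rw [show ι ((ch x).symm u) = _ from (he x).apply_chart_symm hι hu.1]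
  refine ⟨c, hman, ?_, hι⟩
  refine Manifold.IsImmersionOfComplement.isImmersion (F := F) fun x => ?_
  have : Nonempty M := ⟨x⟩
  -- In the charts `ch x` and `e x` the map `ι` reads `u ↦ L (u, 0)`, the normal form of an
  -- immersion.
  refine Manifold.IsImmersionAtOfComplement.mk_of_charts L (ch x) (e x) (hx x) (hx x)
    (IsManifold.subset_maximalAtlas ⟨x, rfl⟩) ?_ (fun y hy => hy) ?_
  · exact (e x).mem_maximalAtlas_of_contMDiffOn (he x).contDiffOn.contMDiffOn
      (he x).contDiffOn_symm.contMDiffOn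
  · intro u hu
    replace hu : u ∈ (ch x).target := by simpa using hu
    change e x (ι ((ch x).symm u)) = L (u, 0)
    rw [show ι ((ch x).symm u) = _ from (he x).apply_chart_symm hι hu]
    exact (e x).right_inv hu

end Slice

/-! ### Submersions and local sections -/

section Submersion

open Set Filter Topology Manifold

variable {m d : ℕ} {M N : Type*} [TopologicalSpace M] [TopologicalSpace N]
  [ChartedSpace (EuclideanSpace ℝ (Fin m)) M] [ChartedSpace (EuclideanSpace ℝ (Fin d)) N]

/-- A smooth map with a smooth local section through each point of its source is a submersion. -/
theorem ContMDiff.isSubmersion_of_exists_section [IsManifold (𝓡 m) ∞ M] [IsManifold (𝓡 d) ∞ N]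
    {f : M → N} (hf : ContMDiff (𝓡 m) (𝓡 d) ∞ f)
    (hsec : ∀ x, ∃ s : N → M, s (f x) = x ∧ ContMDiffAt (𝓡 d) (𝓡 m) ∞ s (f x) ∧
      ∀ᶠ y in 𝓝 (f x), f (s y) = y) :
    IsSubmersion (𝓡 m) (𝓡 d) ∞ f := by
  -- One complement must serve all points; the kernels of the derivatives vary but all have
  -- dimension `m - d`.
  refine ⟨EuclideanSpace ℝ (Fin (m - d)), inferInstance, inferInstance, fun x => ?_⟩
  obtain ⟨s, hsx, hs, hfs⟩ := hsec x
  set c := chartAt (EuclideanSpace ℝ (Fin m)) x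
  set c' := chartAt (EuclideanSpace ℝ (Fin d)) (f x)
  have hcx : x ∈ c.source := mem_chart_source _ x
  have hcx' : f x ∈ c'.source := mem_chart_source _ (f x)
  have hc : c ∈ IsManifold.maximalAtlas (𝓡 m) ∞ M := IsManifold.chart_mem_maximalAtlas x
  have hc' : c' ∈ IsManifold.maximalAtlas (𝓡 d) ∞ N := IsManifold.chart_mem_maximalAtlas (f x)
  -- the map and the section in charts
  set U := c.target ∩ c.symm ⁻¹' (f ⁻¹' c'.source)
  have hU : IsOpen U :=
    c.continuousOn_symm.isOpen_inter_preimage c.open_target (c'.open_source.preimage hf.continuous)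
  have hxU : c x ∈ U := ⟨c.map_source hcx, by simpa [c.left_inv hcx] using hcx'⟩
  let g : EuclideanSpace ℝ (Fin m) → EuclideanSpace ℝ (Fin d) := fun u => c' (f (c.symm u))
  have hg : ContDiffOn ℝ ∞ g U := by
    rw [← contMDiffOn_iff_contDiffOn]
    exact (contMDiffOn_of_mem_maximalAtlas hc').comp
      (hf.comp_contMDiffOn ((contMDiffOn_symm_of_mem_maximalAtlas hc).mono inter_subset_left))
      fun u hu => hu.2
  let k : EuclideanSpace ℝ (Fin d) → EuclideanSpace ℝ (Fin m) := fun w => c (s (c'.symm w))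
  have hk : ContDiffAt ℝ ∞ k (c' (f x)) := by
    rw [← contMDiffAt_iff_contDiffAt]
    have h1 : ContMDiffAt (𝓡 d) (𝓡 d) ∞ c'.symm (c' (f x)) :=
      contMDiffAt_symm_of_mem_maximalAtlas hc' (c'.map_source hcx')
    have h2 : ContMDiffAt (𝓡 d) (𝓡 m) ∞ s (c'.symm (c' (f x))) := by rwa [c'.left_inv hcx']
    have h3 : ContMDiffAt (𝓡 m) (𝓡 m) ∞ c (s (c'.symm (c' (f x)))) :=
      contMDiffAt_of_mem_maximalAtlas hc (by rwa [c'.left_inv hcx', hsx])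
    exact ContMDiffAt.comp (g := c ∘ s) _ (h3.comp _ h2) h1
  have hkx : k (c' (f x)) = c x := by simp only [k, c'.left_inv hcx', hsx]
  have hgk : ∀ᶠ w in 𝓝 (c' (f x)), g (k w) = w := by
    have t1 : Tendsto c'.symm (𝓝 (c' (f x))) (𝓝 (f x)) := c'.tendsto_symm hcx'
    have t2 : ∀ᶠ y in 𝓝 (f x), s y ∈ c.source := by
      have : Tendsto s (𝓝 (f x)) (𝓝 x) := by simpa [ContinuousAt, hsx] using hs.continuousAt
      exact this.eventually (c.open_source.mem_nhds hcx)
    filter_upwards [t1.eventually (hfs.and t2), c'.open_target.mem_nhds (c'.map_source hcx')]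
      with w hw hwt
    simp only [g, k, c.left_inv hw.2, hw.1, c'.right_inv hwt]
  have hgd : HasFDerivAt g (fderiv ℝ g (c x)) (c x) :=
    ((hg.contDiffAt (hU.mem_nhds hxU)).differentiableAt (by simp)).hasFDerivAt
  have hkd : HasFDerivAt k (fderiv ℝ k (c' (f x))) (c' (f x)) :=
    (hk.differentiableAt (by simp)).hasFDerivAt
  set g' := fderiv ℝ g (c x)
  set k' := fderiv ℝ k (c' (f x))
  have hright : Function.RightInverse k' g' := by
    have h1 : HasFDerivAt (g ∘ k) (g'.comp k') (c' (f x)) := by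
      refine HasFDerivAt.comp _ ?_ hkd
      rwa [hkx]
    have h2 := h1.unique ((hasFDerivAt_id (𝕜 := ℝ) (c' (f x))).congr_of_eventuallyEq hgk)
    exact fun v => congrArg
      (fun A : EuclideanSpace ℝ (Fin d) →L[ℝ] EuclideanSpace ℝ (Fin d) => A v) h2
  -- the straightening chart
  let A := ContinuousLinearEquiv.equivOfRightInverse g' k' hright
  have hA1 : ∀ v, (A v).1 = g' v := fun v => rfl
  let G : EuclideanSpace ℝ (Fin m) → EuclideanSpace ℝ (Fin m) := fun u => A.symm (g u, (A u).2)
  have hG : ContDiffOn ℝ ∞ G U :=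
    A.symm.contDiff.comp_contDiffOn
      (hg.prodMk (contDiff_snd.comp A.contDiff).contDiffOn)
  have hG' : HasFDerivAt G ((ContinuousLinearEquiv.refl ℝ (EuclideanSpace ℝ (Fin m)) :
      _ ≃L[ℝ] _) : _ →L[ℝ] _) (c x) := by
    have h1 := A.symm.hasFDerivAt.comp (c x) (hgd.prodMk
      ((ContinuousLinearMap.snd ℝ _ _).hasFDerivAt.comp (c x) A.hasFDerivAt))
    refine HasFDerivAt.congr_fderiv h1 ?_
    refine ContinuousLinearMap.ext fun v => ?_
    exact A.symm_apply_apply v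
  obtain ⟨e, hxe, heU, heG, hes, het⟩ := hG.exists_openPartialHomeomorph hU (by simp) hxU _ hG'
  have hdim : Module.finrank ℝ g'.toLinearMap.ker =
      Module.finrank ℝ (EuclideanSpace ℝ (Fin (m - d))) := by
    have := A.toLinearEquiv.finrank_eq
    rw [Module.finrank_prod] at this
    simp only [finrank_euclideanSpace, Fintype.card_fin] at this ⊢
    omega
  refine IsSubmersionAtOfComplement.trans_F ?_ (ContinuousLinearEquiv.ofFinrankEq hdim)
  refine IsSubmersionAtOfComplement.mk_of_continuousAt hf.continuous.continuousAt A (c.trans e) c'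
    ?_ hcx' ?_ hc' ?_
  · rw [OpenPartialHomeomorph.trans_source]
    exact ⟨hcx, hxe⟩
  · refine (c.trans e).mem_maximalAtlas_of_contMDiffOn (I := 𝓡 m) (n := ∞) ?_ ?_
    · rw [OpenPartialHomeomorph.trans_source]
      exact hes.contMDiffOn.comp ((contMDiffOn_of_mem_maximalAtlas hc).mono inter_subset_left)
        fun y hy => hy.2
    · rw [OpenPartialHomeomorph.trans_target]
      exact (contMDiffOn_symm_of_mem_maximalAtlas hc).comp
        (het.contMDiffOn.mono inter_subset_left) fun y hy => hy.2
  · intro u hu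
    replace hu : u ∈ (c.trans e).target := by simpa using hu
    rw [OpenPartialHomeomorph.trans_target] at hu
    have h1 : G (e.symm u) = u := by rw [← heG, e.right_inv hu.1]
    change g (e.symm u) = (A u).1
    conv_rhs => rw [← h1]
    simp [G]

/-- Smoothness descends along surjective submersions. -/
theorem Manifold.IsSubmersion.contMDiff_of_comp {E' H' N' : Type*} [NormedAddCommGroup E']
    [NormedSpace ℝ E'] [TopologicalSpace H'] {I' : ModelWithCorners ℝ E' H'} [TopologicalSpace N']
    [ChartedSpace H' N'] [IsManifold (𝓡 m) ∞ M] [IsManifold (𝓡 d) ∞ N]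
    {f : M → N} (hf : IsSubmersion (𝓡 m) (𝓡 d) ∞ f)
    (hsurj : Function.Surjective f) {h : N → N'} (hh : ContMDiff (𝓡 m) I' ∞ (h ∘ f)) :
    ContMDiff (𝓡 d) I' ∞ h := by
  intro y
  obtain ⟨x, rfl⟩ := hsurj y
  obtain ⟨F, _, _, hF⟩ := hf
  have H := hF x
  set φ := H.domChart
  set ψ := H.codChart
  have hxφ : x ∈ φ.source := H.mem_domChart_source
  have hxψ : f x ∈ ψ.source := H.mem_codChart_source
  have hw : ∀ u ∈ φ.target, ψ (f (φ.symm u)) = (H.equiv u).1 := fun u hu =>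
    H.writtenInCharts (by simpa using hu)
  -- Freezing the complementary coordinate at its value at `x` turns the normal form into a smooth
  -- local section of `f`, and locally `h` is `h ∘ f` composed with it.
  let q : EuclideanSpace ℝ (Fin d) → EuclideanSpace ℝ (Fin m) := fun w =>
    H.equiv.symm (w, (H.equiv (φ x)).2)
  have hq : ContDiff ℝ ∞ q := H.equiv.symm.contDiff.comp (contDiff_id.prodMk contDiff_const)
  have hqx : q (ψ (f x)) = φ x := by
    have : ψ (f x) = (H.equiv (φ x)).1 := by
      rw [← hw _ (φ.map_source hxφ), φ.left_inv hxφ]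
    simp only [q, this, H.equiv.symm_apply_apply]
  have hqψ : ContMDiffAt (𝓡 d) (𝓡 m) ∞ (q ∘ ψ) (f x) :=
    hq.contMDiff.contMDiffAt.comp _
      (contMDiffAt_of_mem_maximalAtlas H.codChart_mem_maximalAtlas hxψ)
  have ht : ContMDiffAt (𝓡 d) (𝓡 m) ∞ (φ.symm ∘ (q ∘ ψ)) (f x) := by
    refine ContMDiffAt.comp _ ?_ hqψ
    exact contMDiffAt_symm_of_mem_maximalAtlas H.domChart_mem_maximalAtlas
      (by rw [Function.comp_apply, hqx]; exact φ.map_source hxφ)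
  refine ((hh _).comp (f x) ht).congr_of_eventuallyEq ?_
  have htgt : ∀ᶠ y in 𝓝 (f x), q (ψ y) ∈ φ.target :=
    hqψ.continuousAt.eventually (φ.open_target.mem_nhds
      (by rw [Function.comp_apply, hqx]; exact φ.map_source hxφ))
  filter_upwards [htgt, ψ.open_source.mem_nhds hxψ] with y hy hyψ
  have h1 : ψ (f (φ.symm (q (ψ y)))) = ψ y := by
    rw [hw _ hy]
    simp [q]
  have h2 := ψ.injOn (H.source_subset_preimage_source (φ.map_target hy)) hyψ h1
  simp only [Function.comp_apply, h2]

end Submersion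

/-! ### Linear orbits of `Sp(n)` with smooth local sections -/

section Orbit

open Set Filter Topology Manifold

/-- `S` is the orbit of `x₀` under a linear action of `Sp(n)` on `E`, the stabilizer of `x₀` is `H`,
the orbit map extends to a smooth map `F` on matrices and has a smooth local section at `x₀`. -/
structure IsLinearOrbit {n : ℕ} {E : Type} [NormedAddCommGroup E] [NormedSpace ℝ E]
    (S : Set E) [MulAction (CompactSp n) S] (H : Subgroup (CompactSp n)) (F : QMat n n → E)
    (x₀ : S) : Prop where
  contDiff : ContDiff ℝ ω F
  exists_linear : ∃ T : CompactSp n →* Module.End ℝ E,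
    ∀ (P : CompactSp n) (X : S), T P X = (P • X : S)
  apply_eq : ∀ Q : CompactSp n, F Q = (Q • x₀ : S)
  smul_eq_iff : ∀ Q : CompactSp n, Q • x₀ = x₀ ↔ Q ∈ H
  exists_smul_eq : ∀ X : S, ∃ Q : CompactSp n, Q • x₀ = X
  -- Unitarity is required off `S` too, so that `F ∘ σ` maps a full neighbourhood into `S` and is a
  -- retraction.
  exists_section : ∃ σ : E → QMat n n, ContDiffAt ℝ ω σ x₀ ∧ σ x₀ = 1 ∧
    ∀ᶠ X in 𝓝 (x₀ : E), σ X ∈ unitary (QMat n n) ∧ (X ∈ S → F (σ X) = X)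

theorem isEmbedding_val_compactSp {n : ℕ} :
    IsEmbedding (Subtype.val : CompactSp n → QMat n n) := IsEmbedding.subtypeVal

/-- A smooth map into matrices with values in `Sp(n)` is smooth into `Sp(n)`. -/
theorem IsEmbeddedStructure.contMDiffAt_of_val {n m : ℕ}
    {cG : ChartedSpace (EuclideanSpace ℝ (Fin m)) (CompactSp n)}
    (hG : IsEmbeddedStructure (Subtype.val : CompactSp n → QMat n n) m cG)
    {E : Type} [NormedAddCommGroup E] [NormedSpace ℝ E] {s : E → CompactSp n} {x : E}
    (hs : ContDiffAt ℝ ω (fun X => (s X : QMat n n)) x) :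
    ContMDiffAt 𝓘(ℝ, E) (𝓡 m) ∞ s x := by
  have h := hG.isSmoothEmbedding.isImmersion.isImmersionAt (s x)
  rw [ContMDiffAt.iff_comp_isImmersionAt h]
  exact ⟨isEmbedding_val_compactSp.continuousAt_iff.2 hs.continuousAt,
    (hs.of_le (by simp)).contMDiffAt⟩

/-- A continuous lift of a smooth map through an embedded submanifold is smooth. -/
theorem IsEmbeddedStructure.contMDiff_of_comp {M E : Type} [TopologicalSpace M]
    [NormedAddCommGroup E] [NormedSpace ℝ E] {ι : M → E} {d : ℕ}
    {c : ChartedSpace (EuclideanSpace ℝ (Fin d)) M} (h : IsEmbeddedStructure ι d c)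
    {E' H' N : Type*} [NormedAddCommGroup E'] [NormedSpace ℝ E'] [TopologicalSpace H']
    {I' : ModelWithCorners ℝ E' H'} [TopologicalSpace N] [ChartedSpace H' N] {f : N → M}
    (hf : ContMDiff I' 𝓘(ℝ, E) ∞ (ι ∘ f)) : ContMDiff I' (𝓡 d) ∞ f := by
  rw [ContMDiff.iff_comp_isImmersion h.isSmoothEmbedding.isImmersion]
  exact ⟨h.isSmoothEmbedding.isEmbedding.continuous_iff.2 hf.continuous, hf⟩

namespace IsLinearOrbit

variable {n : ℕ} {E : Type} [NormedAddCommGroup E] [NormedSpace ℝ E]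
  {S : Set E} [MulAction (CompactSp n) S] {H : Subgroup (CompactSp n)} {F : QMat n n → E}
  {x₀ : S}

theorem exists_linearEquiv [FiniteDimensional ℝ E] (h : IsLinearOrbit S H F x₀) (P : CompactSp n) :
    ∃ T : E ≃L[ℝ] E, (∀ X : S, T X = (P • X : S)) ∧ ∀ y, T y ∈ S ↔ y ∈ S := by
  obtain ⟨T, hT⟩ := h.exists_linear
  have hl : ∀ Q y, T Q⁻¹ (T Q y) = y := fun Q y => by
    rw [← Module.End.mul_apply, ← map_mul, inv_mul_cancel, map_one, Module.End.one_apply]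
  have hr : ∀ Q y, T Q (T Q⁻¹ y) = y := fun Q y => by have := hl Q⁻¹ y; rwa [inv_inv] at this
  have hmem : ∀ Q y, y ∈ S → T Q y ∈ S := fun Q y hy => by
    rw [hT Q ⟨y, hy⟩]; exact Subtype.coe_prop _
  refine ⟨(LinearEquiv.ofLinearMap (T P) (T P⁻¹) (LinearMap.ext (hr P))
    (LinearMap.ext (hl P))).toContinuousLinearEquiv, hT P, fun y => ⟨fun hy => ?_, hmem P y⟩⟩
  rw [← hl P y]
  exact hmem _ _ hy

/-- The orbit map has a smooth local section through each element of `Sp(n)`. -/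
theorem exists_section_at [FiniteDimensional ℝ E] (h : IsLinearOrbit S H F x₀) (g : CompactSp n) :
    ∃ s : E → CompactSp n, s (F g) = g ∧ ContDiffAt ℝ ω (fun X => (s X : QMat n n)) (F g) ∧
      ∀ᶠ X in 𝓝 (F g), X ∈ S → F (s X) = X := by
  classical
  obtain ⟨σ, hσ, hσ1, hσS⟩ := h.exists_section
  obtain ⟨T, hT, hTS⟩ := h.exists_linearEquiv g
  have hTx : T.symm (F g) = x₀ := by rw [h.apply_eq, ← hT, T.symm_apply_apply]
  -- The value `1` is a default away from the neighbourhood where `σ` is unitary.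
  let s₁ : E → CompactSp n := fun X => if hX : σ X ∈ unitary (QMat n n) then ⟨σ X, hX⟩ else 1
  have hs₁ : ∀ X, σ X ∈ unitary (QMat n n) → (s₁ X : QMat n n) = σ X := fun X hX => by
    simp only [s₁, dif_pos hX]
  have hx₀ : (x₀ : E) = T.symm (F g) := hTx.symm
  have htend : Tendsto T.symm (𝓝 (F g)) (𝓝 (x₀ : E)) := by
    rw [hx₀]
    exact T.symm.continuous.continuousAt
  -- The section at `x₀`, conjugated by the action of `g`.
  refine ⟨fun X => g * s₁ (T.symm X), ?_, ?_, ?_⟩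
  · change g * s₁ (T.symm (F g)) = g
    rw [hTx]
    have : s₁ x₀ = 1 := Subtype.ext (by
      rw [hs₁ _ (by rw [hσ1]; exact one_mem _), hσ1]; rfl)
    rw [this, mul_one]
  · have h1 : ContDiffAt ℝ ω (fun X => (g : QMat n n) * σ (T.symm X)) (F g) := by
      refine (LinearMap.mulLeft ℝ (g : QMat n n)).toContinuousLinearMap.contDiff.contDiffAt.comp
        (F g) (ContDiffAt.comp (F g) ?_ T.symm.contDiff.contDiffAt)
      rwa [hTx]
    refine h1.congr_of_eventuallyEq ?_
    filter_upwards [htend.eventually hσS] with X hX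
    change (g : QMat n n) * (s₁ (T.symm X) : QMat n n) = _
    rw [hs₁ _ hX.1]
  · filter_upwards [htend.eventually hσS] with X hX hXS
    have h2 : F (s₁ (T.symm X)) = T.symm X := by
      rw [hs₁ _ hX.1]
      exact hX.2 ((hTS _).1 (by rwa [T.apply_symm_apply]))
    rw [h.apply_eq, mul_smul, ← hT, ← h.apply_eq, h2, T.apply_symm_apply]

/-- Section followed by orbit map is a local retraction at `x₀`; the action moves its slice chart to
every point of `S`, so a single dimension and a single splitting `L` suffice. -/
theorem exists_isSliceChart [FiniteDimensional ℝ E] (h : IsLinearOrbit S H F x₀) :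
    ∃ (d : ℕ) (F' : Type) (_ : NormedAddCommGroup F') (_ : NormedSpace ℝ F')
      (L : (EuclideanSpace ℝ (Fin d) × F') ≃L[ℝ] E), ∀ x ∈ S, ∃ e : OpenPartialHomeomorph E E,
      IsSliceChart S L e ∧ x ∈ e.source := by
  obtain ⟨s, hs1, hs, hsS⟩ := h.exists_section_at 1
  have hF1 : F (1 : CompactSp n) = x₀ := by rw [h.apply_eq, one_smul]
  rw [hF1] at hs1 hs hsS
  obtain ⟨d, F', _, _, L, e, he, hxe⟩ := exists_isSliceChart_of_retraction (S := S)
    (r := fun X => F (s X)) (x := x₀) (h.contDiff.contDiffAt.comp _ hs) (by rw [hs1, hF1])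
    (by filter_upwards [hsS] with X hX using ⟨by rw [h.apply_eq]; exact Subtype.coe_prop _, hX⟩)
  refine ⟨d, F', _, _, L, fun x hx => ?_⟩
  obtain ⟨Q, hQ⟩ := h.exists_smul_eq ⟨x, hx⟩
  obtain ⟨T, hT, hTS⟩ := h.exists_linearEquiv Q
  refine ⟨_, he.comp_linear T.symm fun y => ?_, ?_⟩
  · rw [← hTS, T.apply_symm_apply]
  · have : T.symm x = x₀ := by
      rw [T.symm_apply_eq, hT, hQ]
    change T.symm x ∈ e.source
    rwa [this]

theorem continuous_smul_base (h : IsLinearOrbit S H F x₀) :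
    Continuous fun Q : CompactSp n => Q • x₀ := by
  rw [continuous_induced_rng]
  exact (h.contDiff.continuous.comp isEmbedding_val_compactSp.continuous).congr h.apply_eq

/-- The coset space is homeomorphic to the orbit. -/
theorem exists_homeomorph [FiniteDimensional ℝ E] (h : IsLinearOrbit S H F x₀) :
    ∃ Φ : (CompactSp n ⧸ H) ≃ₜ S, ∀ Q : CompactSp n, Φ (Q : CompactSp n ⧸ H) = Q • x₀ := by
  have hrel : ∀ P Q : CompactSp n, P • x₀ = Q • x₀ ↔ P⁻¹ * Q ∈ H := fun P Q => by
    rw [← h.smul_eq_iff, mul_smul, inv_smul_eq_iff, eq_comm]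
  let Ψ : CompactSp n ⧸ H → S := Quotient.lift (fun Q : CompactSp n => Q • x₀)
    fun P Q hPQ => (hrel P Q).2 (QuotientGroup.leftRel_apply.1 hPQ)
  have hΨ : ∀ Q : CompactSp n, Ψ (Q : CompactSp n ⧸ H) = Q • x₀ := fun _ => rfl
  have hinj : Function.Injective Ψ := by
    intro x y
    induction x using QuotientGroup.induction_on with | H P =>
    induction y using QuotientGroup.induction_on with | H Q =>
    intro hxy
    exact QuotientGroup.eq.2 ((hrel P Q).1 hxy)
  have hsurj : Function.Surjective Ψ := fun X =>
    let ⟨Q, hQ⟩ := h.exists_smul_eq X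
    ⟨(Q : CompactSp n ⧸ H), hQ⟩
  have hcont : Continuous Ψ := h.continuous_smul_base.quotient_lift _
  let e := Equiv.ofBijective Ψ ⟨hinj, hsurj⟩
  refine ⟨⟨e, hcont, ?_⟩, hΨ⟩
  rw [continuous_iff_continuousAt]
  intro X
  obtain ⟨g, rfl⟩ := h.exists_smul_eq X
  obtain ⟨s, -, hs, hsS⟩ := h.exists_section_at g
  rw [h.apply_eq] at hs hsS
  -- Near `g • x₀` the inverse is the local section followed by the projection.
  have h1 : ContinuousAt (fun Y : S => ((s Y : CompactSp n) : CompactSp n ⧸ H)) (g • x₀) := by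
    refine QuotientGroup.continuous_mk.continuousAt.comp ?_
    refine isEmbedding_val_compactSp.continuousAt_iff.2 ?_
    exact ContinuousAt.comp (f := Subtype.val) (x := g • x₀) hs.continuousAt
      continuous_subtype_val.continuousAt
  refine h1.congr ?_
  filter_upwards [continuous_subtype_val.continuousAt.eventually hsS] with Y hY
  refine (e.symm_apply_eq.2 (Subtype.ext ?_)).symm
  exact (hY Y.2).symm.trans (h.apply_eq _)

/-- The space `M` is left free so that the result applies both to the orbit itself and to the coset
space, where it produces the homogeneous structure. -/
theorem exists_isEmbeddedStructure [FiniteDimensional ℝ E] (h : IsLinearOrbit S H F x₀) {M : Type} [TopologicalSpace M]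
    (Φ : M ≃ₜ S) : ∃ (d : ℕ) (c : ChartedSpace (EuclideanSpace ℝ (Fin d)) M),
      IsEmbeddedStructure (fun x => (Φ x : E)) d c := by
  obtain ⟨d, F', _, _, L, he⟩ := h.exists_isSliceChart
  have hrange : range (fun x => (Φ x : E)) = S := by
    have := Φ.surjective.range_comp (Subtype.val : S → E)
    rwa [Subtype.range_val] at this
  exact ⟨d, exists_isEmbeddedStructure_of_isSliceChart
    (IsEmbedding.subtypeVal.comp Φ.isEmbedding) L fun x => by
      rw [hrange]; exact he _ (Φ x).2⟩

theorem contMDiff_map_val (h : IsLinearOrbit S H F x₀) {m : ℕ}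
    {cG : ChartedSpace (EuclideanSpace ℝ (Fin m)) (CompactSp n)}
    (hG : IsEmbeddedStructure (Subtype.val : CompactSp n → QMat n n) m cG) :
    ContMDiff (𝓡 m) 𝓘(ℝ, E) ∞ fun Q : CompactSp n => F Q :=
  (h.contDiff.of_le (by simp)).contMDiff.comp hG.isSmoothEmbedding.contMDiff

/-- The coset space receives the structure of the orbit. The projection becomes the orbit map,
smooth because `F` is, and the local sections of the orbit map make it a submersion. -/
theorem exists_isHomogeneousStructure [FiniteDimensional ℝ E] (h : IsLinearOrbit S H F x₀) {m : ℕ}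
    {cG : ChartedSpace (EuclideanSpace ℝ (Fin m)) (CompactSp n)}
    (hG : IsEmbeddedStructure (Subtype.val : CompactSp n → QMat n n) m cG) :
    ∃ (d : ℕ) (c : ChartedSpace (EuclideanSpace ℝ (Fin d)) (CompactSp n ⧸ H)),
      IsHomogeneousStructure m cG H d c := by
  obtain ⟨Φ, hΦ⟩ := h.exists_homeomorph
  obtain ⟨d, c, hc⟩ := h.exists_isEmbeddedStructure Φ
  have := hG.isManifold
  have := hc.isManifold
  have hΦF : ∀ Q : CompactSp n, (Φ (Q : CompactSp n ⧸ H) : E) = F Q := fun Q => by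
    rw [hΦ, h.apply_eq]
  refine ⟨d, c, hc.isManifold, ContMDiff.isSubmersion_of_exists_section ?_ fun g => ?_⟩
  · refine hc.contMDiff_of_comp ?_
    convert h.contMDiff_map_val hG using 1
    exact funext hΦF
  · obtain ⟨s, hsg, hs, hsS⟩ := h.exists_section_at g
    rw [← hΦF] at hs hsS
    refine ⟨fun y => s (Φ y), by simp only [hΦF, hsg], ?_, ?_⟩
    · exact ContMDiffAt.comp (f := fun y => (Φ y : E)) _ (hG.contMDiffAt_of_val hs)
        hc.isSmoothEmbedding.contMDiff.contMDiffAt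
    · have hcont : Continuous fun y => (Φ y : E) := continuous_subtype_val.comp Φ.continuous
      filter_upwards [hcont.continuousAt.eventually hsS] with y hy
      refine Φ.injective (Subtype.ext ?_)
      rw [hΦF, hy (Φ y).2]

/-- The orbit is equivariantly diffeomorphic to the coset space. -/
theorem exists_diffeomorph [FiniteDimensional ℝ E] (h : IsLinearOrbit S H F x₀) {m d d' : ℕ}
    {cG : ChartedSpace (EuclideanSpace ℝ (Fin m)) (CompactSp n)}
    {cS : ChartedSpace (EuclideanSpace ℝ (Fin d)) S}
    {cQ : ChartedSpace (EuclideanSpace ℝ (Fin d')) (CompactSp n ⧸ H)}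
    (hG : IsEmbeddedStructure (Subtype.val : CompactSp n → QMat n n) m cG)
    (hS : IsEmbeddedStructure (Subtype.val : S → E) d cS)
    (hQ : IsHomogeneousStructure m cG H d' cQ) :
    ∃ φ : S ≃ₘ^∞⟮𝓡 d, 𝓡 d'⟯ (CompactSp n ⧸ H),
      (∀ (P : CompactSp n) (X : S), φ (P • X) = P • φ X) ∧
      ∀ Q : CompactSp n, (φ.symm (Q : CompactSp n ⧸ H) : E) = F Q := by
  obtain ⟨Φ, hΦ⟩ := h.exists_homeomorph
  have := hG.isManifold
  have := hQ.isManifold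
  have hΦF : ∀ Q : CompactSp n, (Φ (Q : CompactSp n ⧸ H) : E) = F Q := fun Q => by
    rw [hΦ, h.apply_eq]
  have hmk := hQ.isSubmersion.contMDiff
  have hinv : ContMDiff (𝓡 d') (𝓡 d) ∞ Φ := by
    refine hQ.isSubmersion.contMDiff_of_comp QuotientGroup.mk_surjective
      (hS.contMDiff_of_comp ?_)
    convert h.contMDiff_map_val hG using 1
    exact funext hΦF
  have hfwd : ContMDiff (𝓡 d) (𝓡 d') ∞ Φ.symm := by
    intro X
    obtain ⟨g, rfl⟩ := h.exists_smul_eq X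
    obtain ⟨s, -, hs, hsS⟩ := h.exists_section_at g
    rw [h.apply_eq] at hs hsS
    have h1 : ContMDiffAt (𝓡 d) (𝓡 m) ∞ (fun Y : S => s Y) (g • x₀) :=
      (hG.contMDiffAt_of_val hs).comp (g • x₀) hS.isSmoothEmbedding.contMDiff.contMDiffAt
    refine (hmk.contMDiffAt.comp (g • x₀) h1).congr_of_eventuallyEq ?_
    filter_upwards [continuous_subtype_val.continuousAt.eventually hsS] with Y hY
    refine Φ.symm_apply_eq.2 (Subtype.ext ?_)
    rw [Function.comp_apply, hΦF, hY Y.2]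
  refine ⟨⟨Φ.symm.toEquiv, hfwd, hinv⟩, fun P X => ?_, hΦF⟩
  obtain ⟨g, rfl⟩ := h.exists_smul_eq X
  have hsymm : ∀ Q : CompactSp n, Φ.symm (Q • x₀) = (Q : CompactSp n ⧸ H) := fun Q =>
    Φ.symm_apply_eq.2 (hΦ Q).symm
  change Φ.symm (P • g • x₀) = P • Φ.symm (g • x₀)
  rw [← mul_smul, hsymm, hsymm]
  rfl

theorem isEquivariantModel [FiniteDimensional ℝ E] (h : IsLinearOrbit S H F x₀) :
    IsEquivariantModel S H fun Q : CompactSp n => F Q where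
  exists_embedded := h.exists_isEmbeddedStructure (Homeomorph.refl S)
  exists_homogeneous _ _ hG := h.exists_isHomogeneousStructure hG
  exists_diffeomorph _ _ _ _ _ _ hG hS hQ := h.exists_diffeomorph hG hS hQ

end IsLinearOrbit

end Orbit

/-! ### Smooth operations on quaternionic matrices and the polar decomposition near `1` -/

section Polar

open Set Filter Topology

/-- The entrywise sup norm is not submultiplicative in general, so the product is handled entry by
entry here and as a bounded bilinear map below. -/
theorem ContDiffAt.qmat_mul {X : Type*} [NormedAddCommGroup X] [NormedSpace ℝ X] {a b c : ℕ}
    {r : ℕ∞ω} {f : X → QMat a b} {g : X → QMat b c} {x : X} (hf : ContDiffAt ℝ r f x)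
    (hg : ContDiffAt ℝ r g x) : ContDiffAt ℝ r (fun y => f y * g y) x := by
  refine contDiffAt_pi.2 fun i => contDiffAt_pi.2 fun j => ?_
  simp only [Matrix.mul_apply]
  exact ContDiffAt.sum fun l _ => (contDiffAt_pi.1 (contDiffAt_pi.1 hf i) l).mul
    (contDiffAt_pi.1 (contDiffAt_pi.1 hg l) j)

/-- The conjugate transpose as a real linear map. -/
def conjTransposeLinear (a b : ℕ) : QMat a b →ₗ[ℝ] QMat b a where
  toFun := Matrix.conjTranspose
  map_add' := Matrix.conjTranspose_add
  map_smul' r M := by ext i j <;> simp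

theorem ContDiffAt.qmat_conjTranspose {X : Type*} [NormedAddCommGroup X] [NormedSpace ℝ X]
    {a b : ℕ} {r : ℕ∞ω} {f : X → QMat a b} {x : X} (hf : ContDiffAt ℝ r f x) :
    ContDiffAt ℝ r (fun y => (f y)ᴴ) x :=
  (conjTransposeLinear a b).toContinuousLinearMap.contDiff.contDiffAt.comp x hf

theorem ContinuousLinearMap.eq_zero_of_isUnit {V : Type*} [NormedAddCommGroup V]
    [NormedSpace ℝ V] {A : V →L[ℝ] V} (hA : IsUnit A) {v : V} (hv : A v = 0) : v = 0 := by
  obtain ⟨u, rfl⟩ := hA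
  have : ((↑u⁻¹ : V →L[ℝ] V) * (u : V →L[ℝ] V)) v = v := by rw [u.inv_mul]; rfl
  rw [← this, mul_apply_eq_comp, hv, map_zero]

/-- Linear families of operators which are invertible at a point are so near the point. -/
theorem ContinuousLinearMap.eventually_isUnit_apply {V : Type*} [NormedAddCommGroup V]
    [NormedSpace ℝ V] [CompleteSpace V] (A : V →L[ℝ] V →L[ℝ] V) {x : V} (hx : IsUnit (A x)) :
    ∀ᶠ y in 𝓝 x, IsUnit (A y) :=
  A.continuous.continuousAt.eventually (Units.isOpen.mem_nhds hx)

/-! ### Inverses and square roots for a bilinear product with unit. -/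

section UnitalProduct

variable {V : Type*} [NormedAddCommGroup V] [NormedSpace ℝ V] [CompleteSpace V]
  (B : V →L[ℝ] V →L[ℝ] V) {e : V}

/-- Inversion for a unital product is smooth near the unit. -/
theorem exists_smooth_inverse (hl : ∀ v, B e v = v) : ∃ inv : V → V,
    ContDiffAt ℝ ω inv e ∧ inv e = e ∧ ∀ᶠ x in 𝓝 e, B x (inv x) = e := by
  have hB : B e = 1 := ContinuousLinearMap.ext hl
  -- The inverse of `x` is the preimage of `e` under `B x`, obtained by inverting in the Banach
  -- algebra of operators.
  refine ⟨fun x => Ring.inverse (B x) e, ?_, ?_, ?_⟩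
  · have h1 : ContDiffAt ℝ ω (Ring.inverse : (V →L[ℝ] V) → _) (B e) := by
      rw [hB]
      exact contDiffAt_ringInverse ℝ 1
    exact (h1.comp e B.contDiff.contDiffAt).clm_apply contDiffAt_const
  · simp [hB]
  · filter_upwards [B.eventually_isUnit_apply (x := e) (by rw [hB]; exact isUnit_one)] with x hx
    rw [← mul_apply_eq_comp, Ring.mul_inverse_cancel _ hx]
    rfl

/-- Square roots for a unital product near the unit. -/
theorem exists_smooth_sqrt (hl : ∀ v, B e v = v) (hr : ∀ v, B v e = v) : ∃ sq : V → V,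
    ContDiffAt ℝ ω sq e ∧ sq e = e ∧ ∀ᶠ z in 𝓝 e, B (sq z) (sq z) = z := by
  let f : V → V := fun y => B y y
  have hf : ContDiffAt ℝ ω f e := (B.contDiff.clm_apply contDiff_id).contDiffAt
  let A : V ≃L[ℝ] V := ContinuousLinearEquiv.smulLeft (Units.mk0 (2 : ℝ) two_ne_zero)
  -- Squaring has derivative `2` at the unit, so the inverse function theorem applies.
  have hf' : HasFDerivAt f (A : V →L[ℝ] V) e := by
    refine ((B.hasFDerivAt (x := e)).clm_apply (hasFDerivAt_id e)).congr_fderiv ?_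
    refine ContinuousLinearMap.ext fun v => ?_
    change B e v + B v e = (2 : ℝ) • v
    rw [hl, hr, two_smul]
  have hf1 : f e = e := hl e
  have h1 := hf.to_localInverse hf' (by simp)
  have h2 := hf.localInverse_apply_image hf' (by simp)
  have h3 := (hf.hasStrictFDerivAt' hf' (by simp)).eventually_right_inverse
  rw [hf1] at h1 h2 h3
  exact ⟨_, h1, h2, h3⟩

/-- At `c • e` the operator `t ↦ yt + ty` is `2c` times the identity, and invertibility is an open
condition. This replaces uniqueness of positive square roots in the polar decomposition. -/
theorem eventually_anticomm_eq_zero (hl : ∀ v, B e v = v) (hr : ∀ v, B v e = v) {c : ℝ}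
    (hc : c ≠ 0) : ∀ᶠ y in 𝓝 (c • e), ∀ t, B y t + B t y = 0 → t = 0 := by
  have hA : (B + B.flip) (c • e) = (c * 2) • (1 : V →L[ℝ] V) :=
    ContinuousLinearMap.ext fun v => by
      have : c • v + c • v = (c * 2) • v := by rw [mul_two, add_smul]
      simpa [hl, hr] using this
  filter_upwards [(B + B.flip).eventually_isUnit_apply (x := c • e)
    (by rw [hA]; exact (isUnit_one.smul (Units.mk0 (c * 2) (by simpa using hc))))] with y hy t ht
  exact ContinuousLinearMap.eq_zero_of_isUnit hy ht

theorem eventually_mul_eq_zero (hl : ∀ v, B e v = v) {c : ℝ}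
    (hc : c ≠ 0) : ∀ᶠ y in 𝓝 (c • e), ∀ t, B y t = 0 → t = 0 := by
  have hA : B (c • e) = c • (1 : V →L[ℝ] V) :=
    ContinuousLinearMap.ext fun v => by simp [hl]
  filter_upwards [B.eventually_isUnit_apply (x := c • e)
    (by rw [hA]; exact (isUnit_one.smul (Units.mk0 c hc)))] with y hy t ht
  exact ContinuousLinearMap.eq_zero_of_isUnit hy ht

end UnitalProduct

/-- The unitary part of the polar decomposition is smooth near `1`. -/
theorem exists_smooth_polar (n : ℕ) : ∃ pol : QMat n n → QMat n n,
    ContDiffAt ℝ ω pol 1 ∧ pol 1 = 1 ∧ ∀ᶠ W in 𝓝 (1 : QMat n n),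
      pol W ∈ unitary (QMat n n) ∧ ∃ Y Y' : QMat n n, W = pol W * Y ∧ Y * Y' = 1 ∧
        (∀ T, Wᴴ * W * T = T * (Wᴴ * W) → Y * T = T * Y) ∧
        ∀ T, Wᴴ * W * T = T → Y * T = T := by
  have : CompleteSpace (QMat n n) := FiniteDimensional.complete ℝ _
  let B : QMat n n →L[ℝ] QMat n n →L[ℝ] QMat n n := LinearMap.toContinuousLinearMap
    (LinearMap.toContinuousLinearMap.toLinearMap ∘ₗ LinearMap.mul ℝ (QMat n n))
  have hBl : ∀ X, B 1 X = X := Matrix.one_mul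
  have hBr : ∀ X, B X 1 = X := Matrix.mul_one
  obtain ⟨inv, hinv, hinv1, hinvE⟩ := exists_smooth_inverse B hBl
  obtain ⟨sq, hsq, hsq1, hsqE⟩ := exists_smooth_sqrt B hBl hBr
  replace hinvE : ∀ᶠ X in 𝓝 (1 : QMat n n), X * inv X = 1 := hinvE
  replace hsqE : ∀ᶠ Z in 𝓝 (1 : QMat n n), sq Z * sq Z = Z := hsqE
  have hanti1 : ∀ᶠ Y in 𝓝 ((1 : ℝ) • (1 : QMat n n)), ∀ T, Y * T + T * Y = 0 → T = 0 :=
    eventually_anticomm_eq_zero B hBl hBr one_ne_zero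
  have hanti2 : ∀ᶠ Y in 𝓝 ((2 : ℝ) • (1 : QMat n n)), ∀ T, Y * T + T * Y = 0 → T = 0 :=
    eventually_anticomm_eq_zero B hBl hBr two_ne_zero
  have hmul : ∀ᶠ Y in 𝓝 ((2 : ℝ) • (1 : QMat n n)), ∀ T, Y * T = 0 → T = 0 :=
    eventually_mul_eq_zero B hBl two_ne_zero
  rw [one_smul] at hanti1
  rw [two_smul] at hanti2 hmul
  have hZ : ContDiffAt ℝ ω (fun W : QMat n n => Wᴴ * W) 1 :=
    contDiffAt_id.qmat_conjTranspose.qmat_mul contDiffAt_id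
  have hZ1 : (1 : QMat n n)ᴴ * 1 = 1 := by simp
  have hY : ContDiffAt ℝ ω (fun W : QMat n n => sq (Wᴴ * W)) 1 :=
    ContDiffAt.comp (g := sq) 1 (by rwa [hZ1]) hZ
  have hY1 : sq ((1 : QMat n n)ᴴ * 1) = 1 := by rw [hZ1, hsq1]
  have tZ : Tendsto (fun W : QMat n n => Wᴴ * W) (𝓝 1) (𝓝 1) := by
    have := hZ.continuousAt
    rwa [ContinuousAt, hZ1] at this
  have tY : Tendsto (fun W : QMat n n => sq (Wᴴ * W)) (𝓝 1) (𝓝 1) := by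
    have := hY.continuousAt
    rwa [ContinuousAt, hY1] at this
  have tadj : Tendsto (fun Y : QMat n n => Y + Yᴴ) (𝓝 1) (𝓝 (1 + 1)) := by
    have : ContDiffAt ℝ ω (fun Y : QMat n n => Y + Yᴴ) 1 :=
      contDiffAt_id.add contDiffAt_id.qmat_conjTranspose
    have := this.continuousAt
    rwa [ContinuousAt, Matrix.conjTranspose_one] at this
  have tadd : Tendsto (fun Y : QMat n n => Y + 1) (𝓝 1) (𝓝 (1 + 1)) :=
    (continuous_id.add continuous_const).tendsto (1 : QMat n n)
  refine ⟨fun W => W * inv (sq (Wᴴ * W)), ?_, ?_, ?_⟩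
  · exact contDiffAt_id.qmat_mul (ContDiffAt.comp (g := inv) 1 (by rwa [hY1]) hY)
  · change 1 * inv (sq ((1 : QMat n n)ᴴ * 1)) = 1
    rw [hY1, hinv1, one_mul]
  · filter_upwards [tZ.eventually hsqE, tY.eventually hinvE,
      tY.eventually hanti1, (tadj.comp tY).eventually hanti2, (tadd.comp tY).eventually hmul] with W h1 h2 h3 h4 h5
    simp only [Function.comp_apply] at h4 h5
    set Y := sq (Wᴴ * W)
    set Y' := inv Y
    have hYY : Y' * Y = 1 := mul_eq_one_symm h2
    have hherm : Yᴴ = Y := by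
      have h6 : Yᴴ * Yᴴ = Y * Y := by
        rw [← Matrix.conjTranspose_mul, h1]
        simp
      -- `Y` comes from the inverse function theorem, so it is not hermitian by construction. But
      -- `Yᴴ` is a second square root of `WᴴW`, hence `Y - Yᴴ` anticommutes with `Y + Yᴴ`, which is
      -- near `2`.
      have h7 : (Y + Yᴴ) * (Y - Yᴴ) + (Y - Yᴴ) * (Y + Yᴴ) = 0 := by
        calc (Y + Yᴴ) * (Y - Yᴴ) + (Y - Yᴴ) * (Y + Yᴴ) = 2 • (Y * Y - Yᴴ * Yᴴ) := by noncomm_ring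
          _ = 0 := by rw [h6, sub_self, smul_zero]
      exact (sub_eq_zero.1 (h4 _ h7)).symm
    refine ⟨?_, Y, Y', ?_, h2, fun T hT => ?_, fun T hT => ?_⟩
    · rw [mem_compactSp_iff, Matrix.conjTranspose_mul, Matrix.mul_assoc, ← Matrix.mul_assoc Wᴴ, ← h1,
        Matrix.mul_assoc Y, h2, Matrix.mul_one]
      rw [← hherm, ← Matrix.conjTranspose_mul, h2, Matrix.conjTranspose_one]
    · rw [Matrix.mul_assoc, hYY, Matrix.mul_one]
    · have h7 : Y * (Y * T - T * Y) + (Y * T - T * Y) * Y = 0 := by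
        calc Y * (Y * T - T * Y) + (Y * T - T * Y) * Y = Y * Y * T - T * (Y * Y) := by noncomm_ring
          _ = 0 := by rw [h1, hT, sub_self]
      exact sub_eq_zero.1 (h3 _ h7)
    · have h7 : (Y + 1) * (Y * T - T) = 0 := by
        calc (Y + 1) * (Y * T - T) = Y * Y * T - T := by noncomm_ring
          _ = 0 := by rw [h1, hT, sub_self]
      exact sub_eq_zero.1 (h5 _ h7)

end Polar

/-- `Sp(n)` is an embedded submanifold of `ℍ^{n × n}`. -/
theorem exists_isEmbeddedStructure_compactSp (n : ℕ) :
    ∃ (m : ℕ) (cG : ChartedSpace (EuclideanSpace ℝ (Fin m)) (CompactSp n)),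
      IsEmbeddedStructure (Subtype.val : CompactSp n → QMat n n) m cG := by
  obtain ⟨pol, hpol, hpol1, hpolE⟩ := exists_smooth_polar n
  let : MulAction (CompactSp n) ((unitary (QMat n n) : Submonoid (QMat n n)) : Set (QMat n n)) :=
    inferInstanceAs (MulAction (CompactSp n) (CompactSp n))
  -- `Sp(n)` is the orbit of `1` under left multiplication with trivial stabilizer; the section is
  -- `pol`, which fixes unitary matrices because there `Y = 1`.
  have h : IsLinearOrbit ((unitary (QMat n n) : Submonoid (QMat n n)) : Set (QMat n n)) ⊥ id
      ⟨1, one_mem _⟩ :=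
    { contDiff := contDiff_id
      exists_linear := ⟨(Algebra.lmul ℝ (QMat n n)).toMonoidHom.comp
        (unitary (QMat n n)).subtype, fun _ _ => rfl⟩
      apply_eq := fun Q => (mul_one (Q : QMat n n)).symm
      smul_eq_iff := fun Q => by
        rw [Subgroup.mem_bot]
        change Q * 1 = 1 ↔ Q = 1
        rw [mul_one]
      exists_smul_eq := fun Q => ⟨Q, mul_one (Q : CompactSp n)⟩
      exists_section := by
        refine ⟨pol, hpol, hpol1, ?_⟩
        filter_upwards [hpolE] with W hpW
        obtain ⟨hW, Y, _, hWY, _, _, hT⟩ := hpW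
        refine ⟨hW, fun hWS => ?_⟩
        have h1 : Wᴴ * W = 1 := mem_compactSp_iff.1 hWS
        have h2 : Y = 1 := by simpa using hT 1 (by rw [h1, Matrix.one_mul])
        rw [h2, Matrix.mul_one] at hWY
        exact hWY.symm }
  exact h.exists_isEmbeddedStructure (Homeomorph.refl _)

/-! ### Block-diagonal elements of `Sp(n)` -/

theorem twoBlock_injective {n k : ℕ} (hk : k ≤ n) {A A' : QMat k k} {B B' : QMat (n - k) (n - k)}
    (h : twoBlock hk A B = twoBlock hk A' B') : A = A' ∧ B = B' := by
  have h1 := (Matrix.reindex (twoBlockEquiv hk) (twoBlockEquiv hk)).injective h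
  have h2 := Matrix.fromBlocks_inj.1 h1
  exact ⟨h2.1, h2.2.2.2⟩

theorem twoBlock_apply {n k : ℕ} (hk : k ≤ n) (A : QMat k k) (B : QMat (n - k) (n - k))
    (x y : Fin k ⊕ Fin (n - k)) :
    twoBlock hk A B (twoBlockEquiv hk x) (twoBlockEquiv hk y) = Matrix.fromBlocks A 0 0 B x y := by
  simp [twoBlock]

theorem twoBlockEquiv_inl {n k : ℕ} (hk : k ≤ n) (i : Fin k) :
    twoBlockEquiv hk (Sum.inl i) = Fin.castLE hk i := by
  ext; simp [twoBlockEquiv]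

/-- The diagonal blocks are themselves unitary, since `QᴴQ` is computed blockwise. -/
theorem exists_twoBlockHom_eq {n k : ℕ} (hk : k ≤ n) (Q : CompactSp n)
    (h₁ : ∀ i j, (Q : QMat n n) (twoBlockEquiv hk (Sum.inl i)) (twoBlockEquiv hk (Sum.inr j)) = 0)
    (h₂ : ∀ i j, (Q : QMat n n) (twoBlockEquiv hk (Sum.inr i)) (twoBlockEquiv hk (Sum.inl j)) = 0) :
    ∃ W, twoBlockHom hk W = Q := by
  set R := (Q : QMat n n).submatrix (twoBlockEquiv hk) (twoBlockEquiv hk) with hR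
  have hQ : (Q : QMat n n) = twoBlock hk R.toBlocks₁₁ R.toBlocks₂₂ := by
    have h12 : R.toBlocks₁₂ = 0 := Matrix.ext h₁
    have h21 : R.toBlocks₂₁ = 0 := Matrix.ext h₂
    have := R.fromBlocks_toBlocks
    rw [h12, h21] at this
    rw [twoBlock, this, hR]
    simp
  have hu := mem_compactSp_iff.1 Q.2
  rw [hQ, twoBlock_conjTranspose, ← twoBlock_mul, ← twoBlock_one hk] at hu
  obtain ⟨hA, hB⟩ := twoBlock_injective hk hu
  exact ⟨(⟨_, mem_compactSp_iff.2 hA⟩, ⟨_, mem_compactSp_iff.2 hB⟩), Subtype.ext hQ.symm⟩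

theorem exists_flagBlockHom_eq {n p : ℕ} {k : Fin p → ℕ} (hk : StrictMono k) (hn : ∀ j, k j < n)
    (Q : CompactSp n)
    (h : ∀ x y, x.1 ≠ y.1 → (Q : QMat n n) (flagEquiv hk hn x) (flagEquiv hk hn y) = 0) :
    ∃ W, flagBlockHom hk hn W = Q := by
  set R := (Q : QMat n n).submatrix (flagEquiv hk hn) (flagEquiv hk hn) with hR
  have hQ : (Q : QMat n n) = flagBlock hk hn R.blockDiag' := by
    have : Matrix.blockDiagonal' R.blockDiag' = R := by
      refine Matrix.ext fun ⟨x₁, x₂⟩ ⟨y₁, y₂⟩ => ?_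
      by_cases hxy : x₁ = y₁
      · subst hxy
        simp [Matrix.blockDiag'_apply]
      · rw [Matrix.blockDiagonal'_apply_ne _ _ _ hxy]
        exact (h ⟨x₁, x₂⟩ ⟨y₁, y₂⟩ hxy).symm
    rw [flagBlock, this, hR]
    simp
  have hu := mem_compactSp_iff.1 Q.2
  rw [hQ, flagBlock_conjTranspose, ← flagBlock_mul, ← flagBlock_one hk hn] at hu
  have hM := Matrix.blockDiagonal'_injective
    ((Matrix.reindex (flagEquiv hk hn) (flagEquiv hk hn)).injective hu)
  exact ⟨fun j => ⟨_, mem_compactSp_iff.2 (congrFun hM j)⟩, Subtype.ext hQ.symm⟩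

/-! ### The Stiefel manifold -/

/-- The matrix of the first `k` columns of the identity. -/
noncomputable def stiefelBase {n k : ℕ} (hk : k ≤ n) : QMat n k := (1 : QMat n n).submatrix id (Fin.castLE hk)

theorem mul_stiefelBase {n k : ℕ} (hk : k ≤ n) (Q : QMat n n) :
    Q * stiefelBase hk = Q.submatrix id (Fin.castLE hk) := by
  rw [stiefelBase, ← Matrix.submatrix_id_id Q, ← Matrix.submatrix_mul _ _ _ _ _ Function.bijective_id,
    Matrix.mul_one, Matrix.submatrix_submatrix]
  rfl

theorem stiefelBase_mem {n k : ℕ} (hk : k ≤ n) : (stiefelBase hk)ᴴ * stiefelBase hk = 1 := by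
  rw [stiefelBase, Matrix.conjTranspose_submatrix, Matrix.conjTranspose_one,
    ← Matrix.submatrix_mul _ _ _ _ _ Function.bijective_id, Matrix.one_mul,
    Matrix.submatrix_one _ (Fin.castLE_injective hk)]

/-- Counting real dimensions, `4n > 4k`, so `v ↦ Xᴴ v` has a nonzero kernel vector. As `vᴴ v` is a
positive real, a real rescaling normalizes it. -/
theorem exists_orthonormal_column {n k : ℕ} (hk : k < n) (X : QMat n k) :
    ∃ w : QMat n 1, Xᴴ * w = 0 ∧ wᴴ * w = 1 := by
  let T : QMat n 1 →ₗ[ℝ] QMat k 1 :=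
    { toFun := fun v => Xᴴ * v
      map_add' := fun _ _ => Matrix.mul_add _ _ _
      map_smul' := fun _ _ => Matrix.mul_smul _ _ _ }
  have hT : T.ker ≠ ⊥ := T.ker_ne_bot_of_finrank_lt (by
    simpa [Module.finrank_matrix, Quaternion.finrank_eq_four] using hk)
  obtain ⟨v, hv, hv0⟩ := T.ker.exists_mem_ne_zero_of_ne_bot hT
  replace hv : Xᴴ * v = 0 := hv
  set r : ℝ := ∑ l, Quaternion.normSq (v l 0)
  have hvv : vᴴ * v = r • 1 := by
    ext i j : 1
    rw [Subsingleton.elim i 0, Subsingleton.elim j 0]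
    simp only [Matrix.mul_apply, Matrix.conjTranspose_apply, Quaternion.star_mul_self,
      Matrix.smul_apply, Matrix.one_apply_eq, r, Finset.sum_smul]
    refine Finset.sum_congr rfl fun l _ => ?_
    rw [← Algebra.algebraMap_eq_smul_one]
    rfl
  have hr : 0 < r := by
    refine lt_of_le_of_ne (Finset.sum_nonneg fun l _ => Quaternion.normSq_nonneg) fun h0 => hv0 ?_
    have := (Finset.sum_eq_zero_iff_of_nonneg fun l _ => Quaternion.normSq_nonneg).1 h0.symm
    ext l j : 1
    rw [Subsingleton.elim j 0]
    exact Quaternion.normSq_eq_zero.1 (this l (Finset.mem_univ l))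
  refine ⟨(√r)⁻¹ • v, by rw [Matrix.mul_smul, hv, smul_zero], ?_⟩
  have h1 : ((√r)⁻¹ • v)ᴴ = (√r)⁻¹ • vᴴ := (conjTransposeLinear n 1).map_smul _ v
  have h2 : (√r)⁻¹ * ((√r)⁻¹ * r) = 1 := by
    have := (Real.sqrt_pos.2 hr).ne'
    field_simp
    rw [Real.sq_sqrt hr.le]
  rw [h1, Matrix.smul_mul, Matrix.mul_smul, hvv, smul_smul, smul_smul, mul_assoc, h2, one_smul]

/-- Induction on the number `j` of missing columns, adjoining one orthonormal column at a time; it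
gives transitivity on the Stiefel manifold. -/
theorem exists_unitary_extension {n : ℕ} : ∀ (j k : ℕ) (hk : k + j = n) (X : QMat n k),
    Xᴴ * X = 1 → ∃ Q : CompactSp n, (Q : QMat n n).submatrix id (Fin.castLE (by omega)) = X := by
  intro j
  induction j with
  | zero =>
    intro k hk X hX
    obtain rfl : k = n := hk
    exact ⟨⟨X, mem_compactSp_iff.2 hX⟩, rfl⟩
  | succ j ih =>
    intro k hk X hX
    obtain ⟨w, hXw, hw⟩ := exists_orthonormal_column (by omega) X
    have hwX : wᴴ * X = 0 := by
      have := congrArg Matrix.conjTranspose hXw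
      simpa [Matrix.conjTranspose_mul] using this
    have h1 : (Matrix.fromCols X w)ᴴ * Matrix.fromCols X w = 1 := by
      rw [Matrix.conjTranspose_fromCols_eq_fromRows_conjTranspose, Matrix.fromRows_mul_fromCols,
        hX, hXw, hwX, hw, Matrix.fromBlocks_one]
    obtain ⟨Q, hQ⟩ := ih (k + 1) (by omega)
      ((Matrix.fromCols X w).submatrix id finSumFinEquiv.symm) (by
        rw [Matrix.conjTranspose_submatrix,
          ← Matrix.submatrix_mul _ _ _ _ _ Function.bijective_id, h1,
          Matrix.submatrix_one_equiv])
    refine ⟨Q, ?_⟩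
    have h2 := congrArg (fun M : QMat n (k + 1) => M.submatrix id (Fin.castAdd 1)) hQ
    simp only [Matrix.submatrix_submatrix] at h2
    refine Eq.trans ?_ (h2.trans ?_)
    · rfl
    · ext a b : 1
      simp

theorem mul_stiefelBase_eq_iff {n k : ℕ} (hk : k ≤ n) (Q : CompactSp n) :
    (Q : QMat n n) * stiefelBase hk = stiefelBase hk ↔ Q ∈ stiefelSubgroup hk := by
  constructor
  · intro h
    -- `Qᴴ` fixes the base point too, so the first `k` rows of `Q`, like its first `k` columns, are
    -- those of the identity.
    have h' : (Q : QMat n n)ᴴ * stiefelBase hk = stiefelBase hk := by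
      conv_lhs => rw [← h]
      rw [← Matrix.mul_assoc, mem_compactSp_iff.1 Q.2, Matrix.one_mul]
    rw [mul_stiefelBase] at h h'
    have hcol : ∀ (x : Fin n) (i : Fin k), (Q : QMat n n) x (twoBlockEquiv hk (Sum.inl i)) =
        (1 : QMat n n) x (twoBlockEquiv hk (Sum.inl i)) := fun x i => by
      rw [twoBlockEquiv_inl]; exact congrFun (congrFun h x) i
    have hrow : ∀ (x : Fin n) (i : Fin k), (Q : QMat n n) (twoBlockEquiv hk (Sum.inl i)) x =
        (1 : QMat n n) (twoBlockEquiv hk (Sum.inl i)) x := fun x i => by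
      rw [twoBlockEquiv_inl]
      have := congrArg star (congrFun (congrFun h' x) i)
      simpa [stiefelBase, Matrix.one_apply, eq_comm, apply_ite] using this
    obtain ⟨⟨U, W⟩, hUW⟩ := exists_twoBlockHom_eq hk Q (fun i j => by rw [hrow]; simp)
      (fun i j => by rw [hcol]; simp)
    refine ⟨W, ?_⟩
    rw [← hUW]
    have hU : U = 1 := Subtype.ext (Matrix.ext fun i j => by
      have h3 := twoBlock_apply hk (U : QMat k k) (W : QMat (n - k) (n - k)) (Sum.inl i)
        (Sum.inl j)
      rw [show twoBlock hk (U : QMat k k) (W : QMat (n - k) (n - k)) = Q from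
        congrArg Subtype.val hUW, hcol] at h3
      simpa [Matrix.one_apply] using h3.symm)
    rw [hU]
    rfl
  · rintro ⟨W, rfl⟩
    rw [mul_stiefelBase]
    ext x i : 1
    change twoBlock hk 1 (W : QMat (n - k) (n - k)) x (Fin.castLE hk i) =
      (1 : QMat n n) x (Fin.castLE hk i)
    rw [← twoBlock_one hk, ← twoBlockEquiv_inl hk]
    obtain ⟨y, rfl⟩ := (twoBlockEquiv hk).surjective x
    rw [twoBlock_apply, twoBlock_apply]
    cases y <;> rfl

theorem exists_section_stiefel {n k : ℕ} (hk : k ≤ n) : ∃ σ : QMat n k → QMat n n,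
    ContDiffAt ℝ ω σ (stiefelBase hk) ∧ σ (stiefelBase hk) = 1 ∧
    ∀ᶠ X in nhds (stiefelBase hk), σ X ∈ unitary (QMat n n) ∧
      (X ∈ quatStiefel n k → (σ X).submatrix id (Fin.castLE hk) = X) := by
  obtain ⟨pol, hpol, hpol1, hpolE⟩ := exists_smooth_polar n
  set J := stiefelBase hk with hJdef
  have hJ : Jᴴ * J = 1 := stiefelBase_mem hk
  -- For `X` in the Stiefel manifold, `W X` sends the frame `J` to `X` and projects the orthogonal
  -- complement of `J` to that of `X`.
  let W : QMat n k → QMat n n := fun X => X * Jᴴ + (1 - X * Xᴴ) * (1 - J * Jᴴ)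
  have hW : ContDiffAt ℝ ω W J :=
    (contDiffAt_id.qmat_mul contDiffAt_const).add
      ((contDiffAt_const.sub (contDiffAt_id.qmat_mul contDiffAt_id.qmat_conjTranspose)).qmat_mul
        contDiffAt_const)
  have hp : J * Jᴴ * (J * Jᴴ) = J * Jᴴ := by
    rw [Matrix.mul_assoc, ← Matrix.mul_assoc Jᴴ, hJ, Matrix.one_mul]
  have hWJ : W J = 1 := by
    calc W J = 1 - J * Jᴴ + J * Jᴴ * (J * Jᴴ) := by simp only [W]; noncomm_ring
      _ = 1 := by rw [hp, sub_add_cancel]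
  refine ⟨fun X => pol (W X), ContDiffAt.comp (g := pol) J (by rwa [hWJ]) hW, ?_, ?_⟩
  · change pol (W J) = 1
    rw [hWJ, hpol1]
  · have htend : Filter.Tendsto W (nhds J) (nhds 1) := by
      have := hW.continuousAt
      rwa [ContinuousAt, hWJ] at this
    filter_upwards [htend.eventually hpolE] with X hX
    obtain ⟨hu, Y, _, hWY, _, _, hT⟩ := hX
    refine ⟨hu, fun hXS => ?_⟩
    replace hXS : Xᴴ * X = 1 := hXS
    have h1 : W X * J = X := by
      simp only [W, Matrix.add_mul, Matrix.mul_assoc, Matrix.sub_mul, hJ, Matrix.mul_one,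
        Matrix.one_mul, sub_self, Matrix.mul_zero, add_zero]
    have h2 : (W X)ᴴ * X = J := by
      simp only [W, Matrix.conjTranspose_add, Matrix.conjTranspose_mul,
        Matrix.conjTranspose_sub, Matrix.conjTranspose_one, Matrix.conjTranspose_conjTranspose,
        Matrix.add_mul, Matrix.mul_assoc, Matrix.sub_mul, hXS, Matrix.mul_one,
        Matrix.one_mul, sub_self, add_zero]
    -- `WJ = X` and `WᴴX = J` give `WᴴWJ = J`, so `Y` fixes `J`. The square matrix `JJᴴ` stands in
    -- for `J` because the polar statement concerns square matrices.
    have h3 : Y * (J * Jᴴ) = J * Jᴴ := hT _ (by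
      rw [Matrix.mul_assoc, ← Matrix.mul_assoc (W X), h1, ← Matrix.mul_assoc, h2])
    have h4 : Y * J = J := by
      have := congrArg (· * J) h3
      simpa only [Matrix.mul_assoc, hJ, Matrix.mul_one] using this
    rw [← mul_stiefelBase hk, ← hJdef]
    calc pol (W X) * J = pol (W X) * Y * J := by rw [Matrix.mul_assoc, h4]
      _ = X := by rw [← hWY, h1]

/-- Left multiplication by `Sp(n)` as a linear action. -/
noncomputable def mulLeftAction (n k : ℕ) : CompactSp n →* Module.End ℝ (QMat n k) where
  toFun P :=
    { toFun := fun X => (P : QMat n n) * X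
      map_add' := fun _ _ => Matrix.mul_add _ _ _
      map_smul' := fun _ _ => Matrix.mul_smul _ _ _ }
  map_one' := LinearMap.ext fun X => Matrix.one_mul X
  map_mul' P Q := LinearMap.ext fun X => by
    change (P : QMat n n) * (Q : QMat n n) * X = (P : QMat n n) * ((Q : QMat n n) * X)
    exact Matrix.mul_assoc _ _ _

theorem contDiff_submatrix_castLE {n k : ℕ} (hk : k ≤ n) :
    ContDiff ℝ ω fun Q : QMat n n => Q.submatrix id (Fin.castLE hk) :=
  contDiff_pi.2 fun i => contDiff_pi.2 fun j =>
    contDiff_apply_apply (𝕜 := ℝ) (E := ℍ[ℝ]) i (Fin.castLE hk j)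

theorem isLinearOrbit_stiefel {n k : ℕ} (hk : k ≤ n) :
    IsLinearOrbit (quatStiefel n k) (stiefelSubgroup hk)
      (fun Q : QMat n n => Q.submatrix id (Fin.castLE hk))
      ⟨stiefelBase hk, stiefelBase_mem hk⟩ where
  contDiff := contDiff_submatrix_castLE hk
  exists_linear := ⟨mulLeftAction n k, fun _ _ => rfl⟩
  apply_eq Q := (mul_stiefelBase hk Q).symm
  smul_eq_iff Q := Iff.trans Subtype.ext_iff (mul_stiefelBase_eq_iff hk Q)
  exists_smul_eq X := by
    obtain ⟨Q, hQ⟩ := exists_unitary_extension (n - k) k (by omega) (X : QMat n k) X.2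
    exact ⟨Q, Subtype.ext ((mul_stiefelBase hk Q).trans hQ)⟩
  exists_section := exists_section_stiefel hk

/-! ### Conjugation orbits of real diagonal matrices -/

/-- The real diagonal matrix `diag(d_1, …, d_n)`. -/
noncomputable def realDiagonal {n : ℕ} (d : Fin n → ℝ) : QMat n n :=
  Matrix.diagonal fun i => algebraMap ℝ ℍ[ℝ] (d i)

theorem realDiagonal_conjTranspose {n : ℕ} (d : Fin n → ℝ) :
    (realDiagonal d)ᴴ = realDiagonal d := by
  rw [realDiagonal, Matrix.diagonal_conjTranspose]
  congr 1
  ext1 i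
  exact Quaternion.star_coe (d i)

/-- Real scalars are central in `ℍ`, so entrywise the condition reads `(d i - d j) Q i j = 0`. -/
theorem commute_realDiagonal_iff {n : ℕ} (d : Fin n → ℝ) (Q : QMat n n) :
    Q * realDiagonal d = realDiagonal d * Q ↔ ∀ i j, d i ≠ d j → Q i j = 0 := by
  have key : ∀ i j, (Q * realDiagonal d) i j = (realDiagonal d * Q) i j ↔
      (d i ≠ d j → Q i j = 0) := fun i j => by
    rw [realDiagonal, Matrix.mul_diagonal, Matrix.diagonal_mul, ← Algebra.commutes (d j),
      ← sub_eq_zero, ← sub_mul, ← map_sub, ← Algebra.smul_def, smul_eq_zero, sub_eq_zero]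
    tauto
  exact ⟨fun h i j => (key i j).1 (by rw [h]), fun h => Matrix.ext fun i j => (key i j).2 (h i j)⟩

theorem aeval_realDiagonal {n : ℕ} (d : Fin n → ℝ) (p : Polynomial ℝ) :
    Polynomial.aeval (realDiagonal d) p = realDiagonal fun i => p.eval (d i) := by
  let φ : (Fin n → ℝ) →ₐ[ℝ] QMat n n :=
    (Matrix.diagonalAlgHom ℝ).comp ((Algebra.ofId ℝ ℍ[ℝ]).compLeft (Fin n))
  have h1 : Polynomial.aeval (φ d) p = φ (Polynomial.aeval d p) :=
    Polynomial.aeval_algHom_apply φ d p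
  have h2 : Polynomial.aeval d p = fun i => p.eval (d i) := by
    ext i
    have := Polynomial.aeval_algHom_apply (Pi.evalAlgHom ℝ (fun _ : Fin n => ℝ) i) d p
    rw [Polynomial.coe_aeval_eq_eval] at this
    exact this.symm
  rw [h2] at h1
  exact h1

theorem aeval_mul_of_semiconj {n : ℕ} {X Q D : QMat n n} (h : X * Q = Q * D)
    (p : Polynomial ℝ) : Polynomial.aeval X p * Q = Q * Polynomial.aeval D p := by
  induction p using Polynomial.induction_on' with
  | add p q hp hq => rw [map_add, map_add, Matrix.add_mul, Matrix.mul_add, hp, hq]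
  | monomial k a =>
    have hk : X ^ k * Q = Q * D ^ k := by
      induction k with
      | zero => rw [pow_zero, pow_zero, Matrix.one_mul, Matrix.mul_one]
      | succ k ih => rw [pow_succ, pow_succ', Matrix.mul_assoc, h, ← Matrix.mul_assoc, ih,
          Matrix.mul_assoc, ← pow_succ, ← pow_succ']
    rw [Polynomial.aeval_monomial, Polynomial.aeval_monomial, Matrix.mul_assoc, hk,
      ← Matrix.mul_assoc, Algebra.commutes, Matrix.mul_assoc]

theorem contDiff_aeval {n : ℕ} (p : Polynomial ℝ) :
    ContDiff ℝ ω fun X : QMat n n => Polynomial.aeval X p := by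
  rw [contDiff_iff_contDiffAt]
  intro X
  induction p using Polynomial.induction_on' with
  | add p q hp hq =>
    simp only [map_add]
    exact hp.add hq
  | monomial k a =>
    simp only [Polynomial.aeval_monomial]
    refine contDiffAt_const.qmat_mul ?_
    induction k with
    | zero => simpa only [pow_zero] using contDiffAt_const
    | succ k ih =>
      simp only [pow_succ]
      exact ih.qmat_mul contDiffAt_id

open Polynomial in
/-- Near a real diagonal matrix `D` there is a smooth map `W` such that `W(X)` intertwines `D` and
each conjugate `X` of `D`. -/
theorem exists_smooth_intertwiner {n : ℕ} (d : Fin n → ℝ) : ∃ W : QMat n n → QMat n n,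
    ContDiff ℝ ω W ∧ W (realDiagonal d) = 1 ∧ ∀ (X : QMat n n) (Q : CompactSp n),
      X = (Q : QMat n n) * realDiagonal d * (Q : QMat n n)ᴴ →
      X * W X = W X * realDiagonal d := by
  classical
  let s := Finset.univ.image d
  let P : ℝ → QMat n n := fun c => realDiagonal fun i => if d i = c then 1 else 0
  let ℓ : ℝ → ℝ[X] := fun c => Lagrange.basis s id c
  have hdiag : ∀ u v : Fin n → ℝ, realDiagonal u * realDiagonal v =
      realDiagonal fun i => u i * v i := fun u v => by
    simp [realDiagonal, Matrix.diagonal_mul_diagonal]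
  have hinj : Set.InjOn (id : ℝ → ℝ) s := fun _ _ _ _ h => h
  have hself : ∀ i, (ℓ (d i)).eval (d i) = 1 := fun i =>
    Lagrange.eval_basis_self hinj (Finset.mem_image_of_mem d (Finset.mem_univ i))
  have hne : ∀ c i, c ≠ d i → (ℓ c).eval (d i) = 0 := fun c i hc =>
    Lagrange.eval_basis_of_ne (v := id) hc (Finset.mem_image_of_mem d (Finset.mem_univ i))
  -- For a conjugate `X` of the diagonal matrix, `ℓ c (X)` is the spectral projection of `X` at `c`,
  -- and `P c` that of the diagonal matrix; each summand maps eigenspace to eigenspace.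
  refine ⟨fun X => ∑ c ∈ s, aeval X (ℓ c) * P c, ?_, ?_, ?_⟩
  · refine ContDiff.sum fun c _ => contDiff_iff_contDiffAt.2 fun X => ?_
    exact (contDiff_aeval _).contDiffAt.qmat_mul contDiffAt_const
  · have hterm : ∀ c, aeval (realDiagonal d) (ℓ c) * P c =
        realDiagonal fun i => if d i = c then 1 else 0 := fun c => by
      rw [aeval_realDiagonal, hdiag]
      congr 1
      ext i
      by_cases hc : d i = c
      · rw [if_pos hc, mul_one, ← hc, hself]
      · rw [if_neg hc, mul_zero]
    simp only [hterm]
    refine Matrix.ext fun i j => ?_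
    rw [Matrix.sum_apply]
    by_cases hij : i = j
    · subst hij
      simp only [realDiagonal, Matrix.diagonal_apply_eq, Matrix.one_apply_eq]
      rw [Finset.sum_eq_single (d i)]
      · simp
      · intro c _ hc
        simp [hc.symm]
      · intro h
        exact absurd (Finset.mem_image_of_mem d (Finset.mem_univ i)) h
    · simp [realDiagonal, Matrix.diagonal_apply_ne _ hij, Matrix.one_apply_ne hij]
  · intro X Q hX
    have hXQ : X * (Q : QMat n n) = (Q : QMat n n) * realDiagonal d := by
      rw [hX, Matrix.mul_assoc, mem_compactSp_iff.1 Q.2, Matrix.mul_one]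
    have hQQ : (Q : QMat n n) * (Q : QMat n n)ᴴ = 1 := mul_eq_one_symm (mem_compactSp_iff.1 Q.2)
    rw [Finset.mul_sum, Finset.sum_mul]
    refine Finset.sum_congr rfl fun c _ => ?_
    -- `(t - c) ℓ_c(t)` vanishes at every `d i`, so it annihilates the diagonal matrix and hence its
    -- conjugate `X`; thus `X ℓ_c(X) = c ℓ_c(X)`.
    have h0 : aeval X ((Polynomial.X - C c) * ℓ c) = 0 := by
      have h1 := aeval_mul_of_semiconj hXQ ((Polynomial.X - C c) * ℓ c)
      have h2 : aeval (realDiagonal d) ((Polynomial.X - C c) * ℓ c) = 0 := by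
        rw [aeval_realDiagonal]
        have : (fun i => ((Polynomial.X - C c) * ℓ c).eval (d i)) = fun _ => 0 := by
          ext i
          rw [eval_mul]
          by_cases hc : c = d i
          · simp [hc]
          · rw [hne c i hc, mul_zero]
        rw [this]
        simp [realDiagonal]
      rw [h2, Matrix.mul_zero] at h1
      calc aeval X ((Polynomial.X - C c) * ℓ c)
          = aeval X ((Polynomial.X - C c) * ℓ c) * (Q : QMat n n) * (Q : QMat n n)ᴴ := by
            rw [Matrix.mul_assoc, hQQ, Matrix.mul_one]
        _ = 0 := by rw [h1, Matrix.zero_mul]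
    have h3 : X * aeval X (ℓ c) = algebraMap ℝ (QMat n n) c * aeval X (ℓ c) := by
      rw [map_mul, map_sub, aeval_X, aeval_C, Matrix.sub_mul, sub_eq_zero] at h0
      exact h0
    have h4 : P c * realDiagonal d = algebraMap ℝ (QMat n n) c * P c := by
      have h5 : algebraMap ℝ (QMat n n) c = realDiagonal fun _ => c := by
        rw [Matrix.algebraMap_eq_diagonal]; rfl
      rw [h5, hdiag, hdiag]
      congr 1
      ext i
      by_cases hc : d i = c <;> simp [hc]
    rw [← Matrix.mul_assoc, h3, Matrix.mul_assoc (aeval X (ℓ c)), h4, Algebra.commutes,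
      Matrix.mul_assoc]

/-- If `XW = WD` with `X` and `D` hermitian, then `WᴴW` commutes with `D`, hence so does the factor
`Y`, and the unitary part of `W` still intertwines `D` and `X`. -/
theorem exists_section_conj {n : ℕ} (d : Fin n → ℝ) : ∃ σ : QMat n n → QMat n n,
    ContDiffAt ℝ ω σ (realDiagonal d) ∧ σ (realDiagonal d) = 1 ∧
    ∀ᶠ X in nhds (realDiagonal d), σ X ∈ unitary (QMat n n) ∧
      (X ∈ quatConjOrbit (realDiagonal d) → σ X * realDiagonal d * (σ X)ᴴ = X) := by
  obtain ⟨pol, hpol, hpol1, hpolE⟩ := exists_smooth_polar n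
  obtain ⟨W, hW, hW1, hWX⟩ := exists_smooth_intertwiner d
  set D := realDiagonal d with hD
  have hDD : Dᴴ = D := realDiagonal_conjTranspose d
  refine ⟨fun X => pol (W X), ContDiffAt.comp (g := pol) D (by rwa [hW1]) hW.contDiffAt, ?_, ?_⟩
  · change pol (W D) = 1
    rw [hW1, hpol1]
  · have htend : Filter.Tendsto W (nhds D) (nhds 1) := by
      have := hW.contDiffAt (x := D) |>.continuousAt
      rwa [ContinuousAt, hW1] at this
    filter_upwards [htend.eventually hpolE] with X hX
    obtain ⟨hu, Y, Y', hWY, hYY, hT, _⟩ := hX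
    refine ⟨hu, fun hXS => ?_⟩
    obtain ⟨hXX, Q, hXQ⟩ := hXS
    have h1 : X * W X = W X * D := hWX X Q hXQ
    have h1' : (W X)ᴴ * X = D * (W X)ᴴ := by
      have := congrArg Matrix.conjTranspose h1
      rwa [Matrix.conjTranspose_mul, Matrix.conjTranspose_mul, hXX, hDD] at this
    have h2 : Y * D = D * Y := hT D (by
      rw [Matrix.mul_assoc, ← h1, ← Matrix.mul_assoc, h1', Matrix.mul_assoc])
    have h3 : X * pol (W X) = pol (W X) * D := by
      calc X * pol (W X) = X * (pol (W X) * Y) * Y' := by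
            rw [Matrix.mul_assoc, Matrix.mul_assoc, hYY, Matrix.mul_one]
        _ = pol (W X) * Y * D * Y' := by rw [← hWY, h1]
        _ = pol (W X) * D := by
            rw [Matrix.mul_assoc (pol (W X)), h2, Matrix.mul_assoc, Matrix.mul_assoc, hYY,
              Matrix.mul_one]
    rw [← h3, Matrix.mul_assoc, mul_eq_one_symm (mem_compactSp_iff.1 hu), Matrix.mul_one]

/-- Conjugation by `Sp(n)` as a linear action. -/
noncomputable def conjAction (n : ℕ) : CompactSp n →* Module.End ℝ (QMat n n) where
  toFun P :=
    { toFun := fun X => (P : QMat n n) * X * (P : QMat n n)ᴴ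
      map_add' := fun _ _ => by rw [Matrix.mul_add, Matrix.add_mul]
      map_smul' := fun r X => by rw [Matrix.mul_smul, Matrix.smul_mul, RingHom.id_apply] }
  map_one' := LinearMap.ext fun X => by
    change (1 : QMat n n) * X * (1 : QMat n n)ᴴ = X
    simp
  map_mul' P Q := LinearMap.ext fun X => by
    change (P : QMat n n) * (Q : QMat n n) * X * ((P : QMat n n) * (Q : QMat n n))ᴴ =
      (P : QMat n n) * ((Q : QMat n n) * X * (Q : QMat n n)ᴴ) * (P : QMat n n)ᴴ
    simp only [Matrix.conjTranspose_mul, Matrix.mul_assoc]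

theorem contDiff_conj {n : ℕ} (D : QMat n n) : ContDiff ℝ ω fun Q : QMat n n => Q * D * Qᴴ :=
  contDiff_iff_contDiffAt.2 fun _ =>
    (contDiffAt_id.qmat_mul contDiffAt_const).qmat_mul contDiffAt_id.qmat_conjTranspose

theorem mem_quatConjOrbit_self {n : ℕ} (d : Fin n → ℝ) :
    realDiagonal d ∈ quatConjOrbit (realDiagonal d) :=
  ⟨realDiagonal_conjTranspose d, 1, by
    change _ = (1 : QMat n n) * _ * (1 : QMat n n)ᴴ
    simp⟩

/-- Describing `H` by a pattern of zero entries treats Grassmann and flag manifolds at once. -/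
theorem isLinearOrbit_conj {n : ℕ} (d : Fin n → ℝ) (H : Subgroup (CompactSp n))
    (hH : ∀ Q : CompactSp n, Q ∈ H ↔ ∀ i j, d i ≠ d j → (Q : QMat n n) i j = 0) :
    IsLinearOrbit (quatConjOrbit (realDiagonal d)) H
      (fun Q : QMat n n => Q * realDiagonal d * Qᴴ) ⟨realDiagonal d, mem_quatConjOrbit_self d⟩ where
  contDiff := contDiff_conj _
  exists_linear := ⟨conjAction n, fun _ _ => rfl⟩
  apply_eq _ := rfl
  smul_eq_iff Q := by
    rw [hH, ← commute_realDiagonal_iff]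
    refine Iff.trans Subtype.ext_iff ?_
    change (Q : QMat n n) * realDiagonal d * (Q : QMat n n)ᴴ = realDiagonal d ↔ _
    have hQ := mem_compactSp_iff.1 Q.2
    constructor
    · intro h
      conv_rhs => rw [← h]
      rw [Matrix.mul_assoc, hQ, Matrix.mul_one]
    · intro h
      rw [h, Matrix.mul_assoc, mul_eq_one_symm hQ, Matrix.mul_one]
  exists_smul_eq X := by
    obtain ⟨_, Q, hQ⟩ := X.2
    exact ⟨Q, Subtype.ext hQ.symm⟩
  exists_section := exists_section_conj d

theorem isEquivariantModel_conj {n : ℕ} {D : QMat n n} (d : Fin n → ℝ) (hD : D = realDiagonal d)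
    (H : Subgroup (CompactSp n))
    (hH : ∀ Q : CompactSp n, Q ∈ H ↔ ∀ i j, d i ≠ d j → (Q : QMat n n) i j = 0) :
    IsEquivariantModel (quatConjOrbit D) H
      (fun Q : CompactSp n => (Q : QMat n n) * D * (Q : QMat n n)ᴴ) := by
  subst hD
  exact (isLinearOrbit_conj d H hH).isEquivariantModel

/-! ### The Grassmann and flag manifolds -/

theorem grassmannDelta_eq {n k : ℕ} (hk : k ≤ n) : grassmannDelta hk =
    realDiagonal fun i => Sum.elim (fun _ => 1) (fun _ => -1) ((twoBlockEquiv hk).symm i) := by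
  refine Matrix.ext fun i j => ?_
  obtain ⟨x, rfl⟩ := (twoBlockEquiv hk).surjective i
  obtain ⟨y, rfl⟩ := (twoBlockEquiv hk).surjective j
  rw [grassmannDelta, twoBlock_apply, realDiagonal, Matrix.diagonal_apply]
  rcases x with x | x <;> rcases y with y | y <;> simp [Matrix.one_apply]
  split <;> simp

theorem mem_grassmannSubgroup_iff {n k : ℕ} (hk : k ≤ n) (Q : CompactSp n) :
    Q ∈ grassmannSubgroup hk ↔ ∀ i j,
      (Sum.elim (fun _ => 1) (fun _ => -1) ((twoBlockEquiv hk).symm i) : ℝ) ≠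
        Sum.elim (fun _ => 1) (fun _ => -1) ((twoBlockEquiv hk).symm j) →
      (Q : QMat n n) i j = 0 := by
  constructor
  · rintro ⟨W, rfl⟩ i j
    obtain ⟨x, rfl⟩ := (twoBlockEquiv hk).surjective i
    obtain ⟨y, rfl⟩ := (twoBlockEquiv hk).surjective j
    change _ → twoBlock hk (W.1 : QMat k k) (W.2 : QMat (n - k) (n - k)) _ _ = 0
    rw [twoBlock_apply]
    rcases x with x | x <;> rcases y with y | y <;> simp
  · intro h
    exact exists_twoBlockHom_eq hk Q (fun i j => h _ _ (by norm_num))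
      (fun i j => h _ _ (by norm_num))

theorem flagBlock_apply {n p : ℕ} {k : Fin p → ℕ} (hk : StrictMono k) (hn : ∀ j, k j < n)
    (M : ∀ j, QMat (flagSize n k j) (flagSize n k j)) (x y : Σ j, Fin (flagSize n k j)) :
    flagBlock hk hn M (flagEquiv hk hn x) (flagEquiv hk hn y) = Matrix.blockDiagonal' M x y := by
  simp [flagBlock]

theorem flagDelta_eq {n p : ℕ} {k : Fin p → ℕ} (hk : StrictMono k) (hn : ∀ j, k j < n)
    (a : Fin (p + 1) → ℝ) :
    flagDelta hk hn a = realDiagonal fun i => a ((flagEquiv hk hn).symm i).1 := by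
  refine Matrix.ext fun i j => ?_
  obtain ⟨⟨x₁, x₂⟩, rfl⟩ := (flagEquiv hk hn).surjective i
  obtain ⟨⟨y₁, y₂⟩, rfl⟩ := (flagEquiv hk hn).surjective j
  rw [flagDelta, flagBlock_apply, realDiagonal, Matrix.diagonal_apply]
  by_cases hxy : x₁ = y₁
  · subst hxy
    rw [Matrix.blockDiagonal'_apply_eq, Matrix.smul_apply, Matrix.one_apply]
    by_cases h2 : x₂ = y₂
    · simp [h2, Algebra.algebraMap_eq_smul_one]
    · simp [h2]
  · rw [Matrix.blockDiagonal'_apply_ne _ _ _ hxy]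
    simp [hxy]

/-- Distinctness of the `a j` makes equality of eigenvalues the same as lying in the same block. -/
theorem mem_flagSubgroup_iff {n p : ℕ} {k : Fin p → ℕ} (hk : StrictMono k) (hn : ∀ j, k j < n)
    {a : Fin (p + 1) → ℝ} (ha : Function.Injective a) (Q : CompactSp n) :
    Q ∈ flagSubgroup hk hn ↔ ∀ i j,
      a ((flagEquiv hk hn).symm i).1 ≠ a ((flagEquiv hk hn).symm j).1 →
      (Q : QMat n n) i j = 0 := by
  constructor
  · rintro ⟨W, rfl⟩ i j hij
    obtain ⟨⟨x₁, x₂⟩, rfl⟩ := (flagEquiv hk hn).surjective i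
    obtain ⟨⟨y₁, y₂⟩, rfl⟩ := (flagEquiv hk hn).surjective j
    rw [Equiv.symm_apply_apply, Equiv.symm_apply_apply] at hij
    change flagBlock hk hn (fun j => (W j : QMat _ _)) _ _ = 0
    rw [flagBlock_apply]
    exact Matrix.blockDiagonal'_apply_ne _ _ _ fun h => hij (congrArg a h)
  · intro h
    refine exists_flagBlockHom_eq hk hn Q fun x y hxy => h _ _ ?_
    rw [Equiv.symm_apply_apply, Equiv.symm_apply_apply]
    exact ha.ne hxy

theorem mainTheorem11 (n : ℕ) :
    (∃ (m : ℕ) (cG : ChartedSpace (EuclideanSpace ℝ (Fin m)) (CompactSp n)),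
      IsEmbeddedStructure (Subtype.val : CompactSp n → QMat n n) m cG) ∧
    (∀ (k : ℕ) (hk : k ≤ n),
      IsEquivariantModel (quatStiefel n k) (stiefelSubgroup hk)
        (fun Q : CompactSp n => (Q : QMat n n).submatrix id (Fin.castLE hk))) ∧
    (∀ (k : ℕ) (hk : k ≤ n),
      IsEquivariantModel (quatConjOrbit (grassmannDelta hk)) (grassmannSubgroup hk)
        (fun Q : CompactSp n =>
          (Q : QMat n n) * grassmannDelta hk * (Q : QMat n n)ᴴ)) ∧
    (∀ (p : ℕ) (k : Fin p → ℕ) (hk : StrictMono k) (_ : ∀ j, 0 < k j) (hn : ∀ j, k j < n)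
      (a : Fin (p + 1) → ℝ), Function.Injective a →
      IsEquivariantModel (quatConjOrbit (flagDelta hk hn a)) (flagSubgroup hk hn)
        (fun Q : CompactSp n =>
          (Q : QMat n n) * flagDelta hk hn a * (Q : QMat n n)ᴴ)) := by
  refine ⟨exists_isEmbeddedStructure_compactSp n, fun k hk => ?_, fun k hk => ?_,
    fun p k hk _ hn a ha => ?_⟩
  · exact (isLinearOrbit_stiefel hk).isEquivariantModel
  · exact isEquivariantModel_conj _ (grassmannDelta_eq hk) _ (mem_grassmannSubgroup_iff hk)
  · exact isEquivariantModel_conj _ (flagDelta_eq hk hn a) _ (mem_flagSubgroup_iff hk hn ha)
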